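/- Let $\mathbb{T}$ be a relational many-sorted first-order geometric theory (formulae are built from atomic formulae $(x_1,\dots,x_k)\in R$ and $x=_X y$ by finite conjunctions, arbitrary set-indexed disjunctions and $\exists$; axioms are sequents $\phi\vdash_{x_1:X^1,\dots,x_k:X^k}\psi$). Let $P[\mathbb{T}]$ be the propositional geometric theory with * a basic proposition $[n\sim^X m]$ for each sort $X$ and $n,m\in\mathbb{N}$, and a basic proposition $[(n_1,\dots,n_k)\in R]$ for each relation symbol $R\subseteq X^1\times\dots\times X^k$ and $n_1,\dots,n_k\in\mathbb{N}$; * the axioms $[n\sim^X m]\vdash[m\sim^X n]$ and $[n\sim^X m]\wedge[m\sim^X \ell]\vdash[n\sim^X \ell]$; * the axioms $[\vec n\in R]\wedge\bigwedge_i[n_i\sim^{X^i}m_i]\vdash[\vec m\in R]$ and $[\vec n\in R]\vdash\bigwedge_i[n_i\sim^{X^i}n_i]$; * for each axiom $\phi\vdash_{x_1:X^1,\dots,x_k:X^k}\psi$ of $\mathbb{T}$ and all $n_1,\dots,n_k\in\mathbb{N}$, the axiom $\bigwedge_i[n_i\sim^{X^i}n_i]\wedge\phi_{\vec n}\vdash\psi_{\vec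 n}$, where $\phi_{\vec n},\psi_{\vec n}$ arise by replacing the free variables $x_i$ by $n_i$, the atomic formulae $\vec y\in R$ and $x=_Xy$ by $[\vec y\in R]$ and $[x\sim^X y]$, and $\exists x{:}X.\,\chi(x)$ by $\bigvee_{n\in\mathbb{N}}[n\sim^X n]\wedge\chi(n)$. The classifying locale of a propositional geometric theory is the locale whose frame of opens is presented by the basic propositions as generators and the axioms $\phi\vdash\psi$ as relations $\phi\le\psi$. Let $\mathbb{T}_{\cong}$ be the geometric theory of isomorphisms between two models of $\mathbb{T}$: it has two copies $X_1,X_2$, $R_1,R_2$ of every sort and relation symbol, two copies of every axiom, and for each sort $X$ a relation symbol $\alpha^X\subseteq X_1\times X_2$, with axioms saying that each $\alpha^X$ is the graph of a bijection ($(x,y)\in\alpha^X\wedge(x',y')\in\alpha^X\wedge x=x'\dashv\vdash(x,y)\in\alpha^X\wedge(x',y')\in\alpha^X\wedge y=y'$, $\ \vdash_y\exists x.(x,y)\in\alpha^X$, $\ \vdash_x\exists y.(x,y)\in\alpha^X$) and that for each $R$, $\bigwedge_i(x_i,y_i)\in\alpha^{X^i}\wedge\vec x\in R_1\dashv\vdash\bigwedge_i(x_i,y_i)\in\alpha^{X^i}\wedge\vec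 y\in R_2$. Let $\mathbb{T}_{\cong,\cong}$ be the analogous theory with three copies of $\mathbb{T}$ and two families of isomorphisms $\beta^X\subseteq X_1\times X_2$, $\gamma^X\subseteq X_2\times X_3$. Let $G^{\mathbb{T}}$ be the localic groupoid whose locales of objects and of arrows are the classifying locales $G_0^{\mathbb{T}}$ of $P[\mathbb{T}]$ and $G_1^{\mathbb{T}}$ of $P[\mathbb{T}_{\cong}]$, for which $G_1^{\mathbb{T}}\times_{G_0^{\mathbb{T}}}G_1^{\mathbb{T}}$ is the classifying locale of $P[\mathbb{T}_{\cong,\cong}]$, and whose structure maps are given by the following frame homomorphisms, where $[n\sim^X m]$ is treated as the case of $R$ being equality on $X$: $$\begin{aligned} s^*&:[\vec n\in R]\mapsto[\vec n\in R_1],\qquad t^*:[\vec n\in R]\mapsto[\vec n\in R_2],\\ e^*&:[\vec n\in R_1],[\vec n\in R_2]\mapsto[\vec n\in R],\quad[\alpha^X(n)=m]\mapsto[n\sim^X m],\\ i^*&:[\vec n\in R_1]\mapsto[\vec n\in R_2],\quad[\vec n\in R_2]\mapsto[\vec n\in R_1],\quad[\alpha^X(n)=m]\mapsto[\alpha^X(m)=n],\\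 m^*&:[\vec n\in R_1]\mapsto[\vec n\in R_1],\quad[\vec n\in R_2]\mapsto[\vec n\in R_3],\quad[\alpha^X(n)=p]\mapsto\bigvee_{m\in\mathbb{N}}[\beta^X(n)=m]\wedge[\gamma^X(m)=p]. \end{aligned}$$ **Proposition.** Suppose that $\mathbb{T}$ has countably many sorts, countably many relation symbols and countably many axioms. Then $G_0^{\mathbb{T}}$, $G_1^{\mathbb{T}}$ and $G_1^{\mathbb{T}}\times_{G_0^{\mathbb{T}}}G_1^{\mathbb{T}}$ are countably presented locales (their frames of opens have presentations with countably many generators and countably many relations), and they are spatial (isomorphic to the locale of open sets of a topological space). Moreover $G^{\mathbb{T}}$ arises from a topological groupoid: there are a topological groupoid $H$ and isomorphisms of locales from the locales of open sets of $H_0$, $H_1$ and $H_1\times_{H_0}H_1$ to $G_0^{\mathbb{T}}$, $G_1^{\mathbb{T}}$ and $G_1^{\mathbb{T}}\times_{G_0^{\mathbb{T}}}G_1^{\mathbb{T}}$ that commute with the source, target, identity, inversion and composition maps and with the two projections from the locale of composable pairs. -/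

import Mathlib

universe u w v v'

namespace Geom

open CategoryTheory Order

/-- The free frame on a set `G` of generators: the lower sets of the free meet-semilattice on `G`,
which is the set of finite subsets of `G` (a finite subset stands for the meet of its elements)
ordered by reverse inclusion. -/
abbrev FreeFrame (G : Type u) : Type u := LowerSet (Finset G)ᵒᵈ

namespace FreeFrame

variable {G : Type u} {F : Type v} [Frame F]

/-- The generator `g` of the free frame. -/
def of (g : G) : FreeFrame G := LowerSet.Iic (OrderDual.toDual {g})

/-- The frame homomorphism out of the free frame that extends a map on generators. -/
def lift (f : G → F) : FrameHom (FreeFrame G) F where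
  toFun U := ⨆ a ∈ U, (OrderDual.ofDual a).inf f
  map_inf' U V := by
    classical
    apply le_antisymm
    · refine iSup₂_le fun a ha => le_inf ?_ ?_
      · exact le_iSup₂_of_le a ha.1 le_rfl
      · exact le_iSup₂_of_le a ha.2 le_rfl
    · rw [iSup₂_inf_eq]
      refine iSup₂_le fun a ha => ?_
      rw [inf_iSup₂_eq]
      refine iSup₂_le fun b hb => ?_
      refine le_iSup₂_of_le (OrderDual.toDual (OrderDual.ofDual a ∪ OrderDual.ofDual b)) ?_ ?_
      · exact ⟨U.lower (OrderDual.toDual_le.2 Finset.subset_union_left) ha,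
          V.lower (OrderDual.toDual_le.2 Finset.subset_union_right) hb⟩
      · simp [Finset.inf_union]
  map_top' := by
    refine le_antisymm le_top ?_
    exact le_iSup₂_of_le (OrderDual.toDual ∅) trivial (by simp)
  map_sSup' S := by
    apply le_antisymm
    · refine iSup₂_le fun a ha => ?_
      obtain ⟨U, hU, haU⟩ := LowerSet.mem_sSup_iff.1 ha
      exact le_sSup_of_le ⟨U, hU, rfl⟩ (le_iSup₂_of_le a haU le_rfl)
    · refine sSup_le ?_
      rintro _ ⟨U, hU, rfl⟩
      exact iSup₂_le fun a ha => le_iSup₂_of_le a (LowerSet.mem_sSup_iff.2 ⟨U, hU, ha⟩) le_rfl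

theorem lift_of (f : G → F) (g : G) : lift f (of g) = f g := by
  apply le_antisymm
  · refine iSup₂_le fun a ha => ?_
    have : g ∈ OrderDual.ofDual a := by
      have h : ({g} : Finset G) ⊆ OrderDual.ofDual a := ha
      simpa using h
    exact Finset.inf_le this
  · exact le_iSup₂_of_le (OrderDual.toDual {g}) (LowerSet.mem_Iic_iff.2 le_rfl) (by simp)

theorem hom_ext {f g : FrameHom (FreeFrame G) F} (h : ∀ x, f (of x) = g (of x)) : f = g := by
  classical
  have key : ∀ s : Finset G, f (LowerSet.Iic (OrderDual.toDual s))
      = g (LowerSet.Iic (OrderDual.toDual s)) := by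
    intro s
    induction s using Finset.induction_on with
    | empty =>
      have : LowerSet.Iic (OrderDual.toDual (∅ : Finset G)) = ⊤ := by
        apply top_unique
        intro a _
        exact Finset.empty_subset (OrderDual.ofDual a)
      rw [this, map_top, map_top]
    | insert a s _ ih =>
      have : LowerSet.Iic (OrderDual.toDual (insert a s)) = of a ⊓ LowerSet.Iic (OrderDual.toDual s) := by
        ext b
        change insert a s ⊆ OrderDual.ofDual b ↔ {a} ⊆ OrderDual.ofDual b ∧ s ⊆ OrderDual.ofDual b
        rw [Finset.insert_subset_iff, Finset.singleton_subset_iff]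
      rw [this, map_inf, map_inf, ih, h]
  refine DFunLike.ext _ _ fun U => ?_
  have hU : U = ⨆ a ∈ U, LowerSet.Iic a := by
    ext b
    simp only [SetLike.mem_coe, LowerSet.mem_iSup_iff, LowerSet.mem_Iic_iff]
    exact ⟨fun hb => ⟨b, hb, le_rfl⟩, fun ⟨a, ha, hb⟩ => U.lower hb ha⟩
  rw [hU, map_iSup₂, map_iSup₂]
  exact iSup_congr fun a => iSup_congr fun _ => key a

end FreeFrame

/-- A presentation of a frame: a set of generators and a set of relations `a ≤ b` between elements
of the free frame on the generators. -/
structure Presentation where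
  /-- The generators. -/
  Gen : Type u
  /-- The relations: the pair `(a, b)` stands for `a ≤ b`. -/
  rel : Set (FreeFrame Gen × FreeFrame Gen)

namespace Presentation

variable (P : Presentation.{u}) {F : Type v} [Frame F]

/-- The least nucleus on the free frame that forces all relations. -/
def nucleus : Nucleus (FreeFrame P.Gen) := sInf {j | ∀ r ∈ P.rel, r.1 ≤ j r.2}

/-- The presented frame. -/
abbrev frame : Type u := Set.range P.nucleus

/-- The image of a generator in the presented frame. -/
def gen (g : P.Gen) : P.frame := P.nucleus.restrict (FreeFrame.of g)

/-- The locale classifying the presentation: its frame of opens is the presented frame. -/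
def locale : Locale.{u} := Locale.of P.frame

theorem le_nucleus {r : FreeFrame P.Gen × FreeFrame P.Gen} (hr : r ∈ P.rel) :
    r.1 ≤ P.nucleus r.2 := by
  simp only [nucleus, Nucleus.sInf_apply, le_iInf_iff]
  exact fun j hj => hj r hr

theorem restrict_le {r : FreeFrame P.Gen × FreeFrame P.Gen} (hr : r ∈ P.rel) :
    P.nucleus.restrict r.1 ≤ P.nucleus.restrict r.2 :=
  (P.nucleus.giRestrict.gc _ _).2 (P.le_nucleus hr)

/-- The nucleus `a ↦ f_* (f a)` of a frame homomorphism. -/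
def homNucleus {E : Type u} [Frame E] (f : FrameHom E F) : Nucleus E where
  toFun a := sSup {b | f b ≤ f a}
  map_inf' a b := by
    apply le_antisymm
    · refine le_inf (sSup_le_sSup fun c hc => ?_) (sSup_le_sSup fun c hc => ?_)
      · exact le_trans hc (by rw [map_inf]; exact inf_le_left)
      · exact le_trans hc (by rw [map_inf]; exact inf_le_right)
    · refine le_sSup ?_
      simp only [Set.mem_ofPred_eq, map_inf, map_sSup]
      refine inf_le_inf (sSup_le ?_) (sSup_le ?_) <;> rintro _ ⟨c, hc, rfl⟩ <;> exact hc
  idempotent' a := by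
    refine sSup_le_sSup fun c hc => le_trans hc ?_
    rw [map_sSup]
    exact sSup_le (by rintro _ ⟨c, hc, rfl⟩; exact hc)
  le_apply' a := le_sSup le_rfl

theorem map_homNucleus {E : Type u} [Frame E] (f : FrameHom E F) (a : E) :
    f (homNucleus f a) ≤ f a := by
  change f (sSup {b | f b ≤ f a}) ≤ f a
  rw [map_sSup]
  exact sSup_le (by rintro _ ⟨c, hc, rfl⟩; exact hc)

variable {P}

theorem map_nucleus {f : FrameHom (FreeFrame P.Gen) F} (hf : ∀ r ∈ P.rel, f r.1 ≤ f r.2)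
    (a : FreeFrame P.Gen) : f (P.nucleus a) = f a := by
  apply le_antisymm
  · have : P.nucleus ≤ homNucleus f := sInf_le fun r hr => le_sSup (hf r hr)
    exact (OrderHomClass.mono f (this a)).trans (map_homNucleus f a)
  · exact OrderHomClass.mono f P.nucleus.le_apply

/-- The universal property of the presented frame. -/
def lift (f : P.Gen → F) (hf : ∀ r ∈ P.rel, FreeFrame.lift f r.1 ≤ FreeFrame.lift f r.2) :
    FrameHom P.frame F where
  toFun a := FreeFrame.lift f a.1
  map_inf' a b := by
    rw [P.nucleus.giRestrict.gc.u_inf, map_inf]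
  map_top' := by
    rw [P.nucleus.giRestrict.gc.u_top, map_top]
  map_sSup' S := by
    have h : sSup S = P.nucleus.restrict (sSup (Subtype.val '' S)) := by
      rw [P.nucleus.giRestrict.l_sSup_u_image]
    have h2 : (P.nucleus.restrict (sSup (Subtype.val '' S))).1
        = P.nucleus (sSup (Subtype.val '' S)) := rfl
    rw [h, h2, map_nucleus hf, map_sSup, Set.image_image]

theorem lift_gen (f : P.Gen → F)
    (hf : ∀ r ∈ P.rel, FreeFrame.lift f r.1 ≤ FreeFrame.lift f r.2) (g : P.Gen) :
    lift f hf (P.gen g) = f g := by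
  change FreeFrame.lift f (P.nucleus (FreeFrame.of g)) = f g
  rw [map_nucleus hf, FreeFrame.lift_of]

theorem hom_ext {f g : FrameHom P.frame F} (h : ∀ x, f (P.gen x) = g (P.gen x)) : f = g := by
  have : f.comp P.nucleus.restrict = g.comp P.nucleus.restrict := FreeFrame.hom_ext h
  refine DFunLike.ext _ _ fun a => ?_
  rw [← P.nucleus.giRestrict.l_u_eq a]
  exact DFunLike.congr_fun this a.1

end Presentation

/-- A (relational, many-sorted) signature. -/
structure Signature where
  /-- The sorts. -/
  Sorts : Type u
  /-- The relation symbols. -/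
  Rels : Type u
  /-- The number of arguments of a relation symbol. -/
  arity : Rels → ℕ
  /-- The sorts of the arguments of a relation symbol. -/
  dom : (R : Rels) → Fin (arity R) → Sorts

/-- Geometric formulae in a context `Γ` of `n` variables: the `i`-th variable has the sort `Γ i`.
The quantifier `ex` binds the variable with the index `0`. -/
inductive Formula (L : Signature.{u}) : (n : ℕ) → (Fin n → L.Sorts) → Type (max u (w + 1))
  | rel {n : ℕ} {Γ : Fin n → L.Sorts} (R : L.Rels) (x : Fin (L.arity R) → Fin n)
      (h : ∀ j, Γ (x j) = L.dom R j) : Formula L n Γ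
  | eq {n : ℕ} {Γ : Fin n → L.Sorts} (i j : Fin n) (h : Γ i = Γ j) : Formula L n Γ
  | conj {n : ℕ} {Γ : Fin n → L.Sorts} {k : ℕ} (φ : Fin k → Formula L n Γ) : Formula L n Γ
  | disj {n : ℕ} {Γ : Fin n → L.Sorts} {ι : Type w} (φ : ι → Formula L n Γ) : Formula L n Γ
  | ex {n : ℕ} {Δ : Fin (n + 1) → L.Sorts} (φ : Formula L (n + 1) Δ) :
      Formula L n (fun i => Δ i.succ)

/-- The binary conjunction. -/
def Formula.and {L : Signature.{u}} {n : ℕ} {Γ : Fin n → L.Sorts} (φ ψ : Formula.{u, w} L n Γ) :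
    Formula.{u, w} L n Γ :=
  .conj ![φ, ψ]

/-- The true formula. -/
def Formula.top {L : Signature.{u}} {n : ℕ} {Γ : Fin n → L.Sorts} : Formula.{u, w} L n Γ :=
  .conj ![]

/-- A sequent `lhs ⊢ rhs` in the context `ctx`. -/
structure Sequent (L : Signature.{u}) where
  /-- The number of variables of the context. -/
  len : ℕ
  /-- The sorts of the variables of the context. -/
  ctx : Fin len → L.Sorts
  /-- The hypothesis. -/
  lhs : Formula.{u, w} L len ctx
  /-- The conclusion. -/
  rhs : Formula.{u, w} L len ctx

/-- A geometric theory. -/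
structure GeomTheory where
  /-- The signature. -/
  sig : Signature.{u}
  /-- The axioms. -/
  axioms : Set (Sequent.{u, w} sig)

/-- A geometric theory is countable if it has countably many sorts, relation symbols and axioms. -/
structure GeomTheory.IsCountable (T : GeomTheory.{u, w}) : Prop where
  sorts : Countable T.sig.Sorts
  rels : Countable T.sig.Rels
  axioms : T.axioms.Countable

/-! ### The propositional theory of a geometric theory -/

/-- The basic propositions `[n ∼ m]` (for a sort `X`) and `[(n₁, …, nₖ) ∈ R]`. -/
inductive BasicProp (L : Signature.{u}) : Type u
  | sim (X : L.Sorts) (n m : ℕ) : BasicProp L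
  | mem (R : L.Rels) (n : Fin (L.arity R) → ℕ) : BasicProp L

/-- An assignment of elements of `F` to the basic propositions. -/
@[ext]
structure Interp (L : Signature.{u}) (F : Type v) where
  /-- The value of `[n ∼ m]`. -/
  sim : L.Sorts → ℕ → ℕ → F
  /-- The value of `[(n₁, …, nₖ) ∈ R]`. -/
  mem : (R : L.Rels) → (Fin (L.arity R) → ℕ) → F

/-- The value of the formula `φ` with its free variables replaced by the natural numbers `ν`.
Conjunctions become meets, disjunctions become joins, atomic formulae become basic propositions,
and `∃ x : X, χ` becomes the join of the `[m ∼ m] ⊓ χ(m)` over all `m : ℕ`. The bound variable is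
restricted to the natural numbers that represent an element of `X`, as the free variables are in
`GeomTheory.PropAxiom.ax` below; if every disjunct of `χ` contains an atomic formula in which
`x` occurs, this agrees with the join of the `χ(m)` modulo the axioms below. -/
def Formula.val {L : Signature.{u}} {F : Type v} [CompleteLattice F] (M : Interp L F) :
    {n : ℕ} → {Γ : Fin n → L.Sorts} → Formula.{u, w} L n Γ → (Fin n → ℕ) → F
  | _, _, .rel R x _, ν => M.mem R (fun j => ν (x j))
  | _, Γ, .eq i j _, ν => M.sim (Γ i) (ν i) (ν j)
  | _, _, .conj φ, ν => ⨅ a, (φ a).val M ν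
  | _, _, .disj φ, ν => ⨆ a, (φ a).val M ν
  | _, _, .ex (Δ := Δ) φ, ν => ⨆ m : ℕ, M.sim (Δ 0) m m ⊓ φ.val M (Fin.cons m ν)

/-- The axioms `a ⊢ b` of the propositional theory of `T`, for an assignment `M` of elements of `F`
to the basic propositions. -/
inductive GeomTheory.PropAxiom (T : GeomTheory.{u, w}) {F : Type v} [CompleteLattice F]
    (M : Interp T.sig F) : F → F → Prop
  | symm (X : T.sig.Sorts) (n m : ℕ) : PropAxiom T M (M.sim X n m) (M.sim X m n)
  | trans (X : T.sig.Sorts) (n m l : ℕ) :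
      PropAxiom T M (M.sim X n m ⊓ M.sim X m l) (M.sim X n l)
  | congr (R : T.sig.Rels) (n m : Fin (T.sig.arity R) → ℕ) :
      PropAxiom T M (M.mem R n ⊓ ⨅ j, M.sim (T.sig.dom R j) (n j) (m j)) (M.mem R m)
  | strict (R : T.sig.Rels) (n : Fin (T.sig.arity R) → ℕ) :
      PropAxiom T M (M.mem R n) (⨅ j, M.sim (T.sig.dom R j) (n j) (n j))
  | ax (σ : Sequent.{u, w} T.sig) (hσ : σ ∈ T.axioms) (ν : Fin σ.len → ℕ) :
      PropAxiom T M ((⨅ i, M.sim (σ.ctx i) (ν i) (ν i)) ⊓ σ.lhs.val M ν) (σ.rhs.val M ν)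

/-- The assignment of the generators of the free frame. -/
def Interp.free (L : Signature.{u}) : Interp L (FreeFrame (BasicProp L)) where
  sim X n m := FreeFrame.of (.sim X n m)
  mem R n := FreeFrame.of (.mem R n)

/-- The propositional geometric theory `P[T]` of the geometric theory `T`, as a presentation of
a frame by the basic propositions and the axioms. -/
def GeomTheory.P (T : GeomTheory.{u, w}) : Presentation.{u} where
  Gen := BasicProp T.sig
  rel := {r | T.PropAxiom (Interp.free T.sig) r.1 r.2}

/-! ### The theory of chains of isomorphisms of models -/

/-- The signature with `k + 1` copies `X₀, …, Xₖ` and `R₀, …, Rₖ` of each sort `X` and of each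
relation symbol `R`, and with a relation symbol `αᵢ ⊆ Xᵢ × Xᵢ₊₁` for each `i < k` and each
sort `X`. -/
def Signature.chain (L : Signature.{u}) (k : ℕ) : Signature.{u} where
  Sorts := Fin (k + 1) × L.Sorts
  Rels := (Fin (k + 1) × L.Rels) ⊕ (Fin k × L.Sorts)
  arity := Sum.elim (fun R => L.arity R.2) (fun _ => 2)
  dom := fun R => match R with
    | .inl R => fun j => (R.1, L.dom R.2 j)
    | .inr a => ![(a.1.castSucc, a.2), (a.1.succ, a.2)]

section chain

variable {L : Signature.{u}} {k : ℕ}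

/-- The `c`-th copy of a formula. -/
def Formula.copy (c : Fin (k + 1)) : {n : ℕ} → {Γ : Fin n → L.Sorts} → Formula.{u, w} L n Γ →
    Formula.{u, w} (L.chain k) n (fun i => (c, Γ i))
  | _, _, .rel R x h => .rel (L := L.chain k) (.inl (c, R)) x (fun j => congrArg (Prod.mk c) (h j))
  | _, _, .eq i j h => .eq i j (congrArg (Prod.mk c) h)
  | _, _, .conj φ => .conj (fun a => (φ a).copy c)
  | _, _, .disj φ => .disj (fun a => (φ a).copy c)
  | _, _, .ex φ => .ex (φ.copy c)

/-- The `c`-th copy of a sequent. -/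
def Sequent.copy (c : Fin (k + 1)) (σ : Sequent.{u, w} L) : Sequent.{u, w} (L.chain k) :=
  ⟨σ.len, fun i => (c, σ.ctx i), σ.lhs.copy c, σ.rhs.copy c⟩

/-- The formula `(x, y) ∈ αᵢ` for variables `x` of the sort `Xᵢ` and `y` of the sort `Xᵢ₊₁`. -/
def Formula.graph {n : ℕ} {Γ : Fin n → (L.chain k).Sorts} (i : Fin k) (X : L.Sorts) (x y : Fin n)
    (hx : Γ x = (i.castSucc, X)) (hy : Γ y = (i.succ, X)) : Formula.{u, w} (L.chain k) n Γ :=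
  .rel (L := L.chain k) (.inr (i, X)) ![x, y] (Fin.forall_fin_two.2 ⟨hx, hy⟩)

/-- The context `x x' : Xᵢ, y y' : Xᵢ₊₁`. -/
def pairCtx (L : Signature.{u}) {k : ℕ} (i : Fin k) (X : L.Sorts) : Fin 4 → (L.chain k).Sorts :=
  ![(i.castSucc, X), (i.castSucc, X), (i.succ, X), (i.succ, X)]

/-- `(x, y) ∈ αᵢ ∧ (x', y') ∈ αᵢ ∧ x = x'` in the context `x x' : Xᵢ, y y' : Xᵢ₊₁`. -/
def pairEqLeft (i : Fin k) (X : L.Sorts) : Formula.{u, w} (L.chain k) 4 (pairCtx L i X) :=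
  ((Formula.graph i X 0 2 rfl rfl).and (Formula.graph i X 1 3 rfl rfl)).and (.eq 0 1 rfl)

/-- `(x, y) ∈ αᵢ ∧ (x', y') ∈ αᵢ ∧ y = y'` in the context `x x' : Xᵢ, y y' : Xᵢ₊₁`. -/
def pairEqRight (i : Fin k) (X : L.Sorts) : Formula.{u, w} (L.chain k) 4 (pairCtx L i X) :=
  ((Formula.graph i X 0 2 rfl rfl).and (Formula.graph i X 1 3 rfl rfl)).and (.eq 2 3 rfl)

/-- The sequent `⊢ ∃ x : Xᵢ, (x, y) ∈ αᵢ` in the context `y : Xᵢ₊₁`. -/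
def surjSeq (i : Fin k) (X : L.Sorts) : Sequent.{u, w} (L.chain k) where
  len := 1
  ctx := fun j => (![(i.castSucc, X), (i.succ, X)] : Fin 2 → (L.chain k).Sorts) j.succ
  lhs := .top
  rhs := .ex (.graph i X 0 1 rfl rfl)

/-- The sequent `⊢ ∃ y : Xᵢ₊₁, (x, y) ∈ αᵢ` in the context `x : Xᵢ`. -/
def totalSeq (i : Fin k) (X : L.Sorts) : Sequent.{u, w} (L.chain k) where
  len := 1
  ctx := fun j => (![(i.succ, X), (i.castSucc, X)] : Fin 2 → (L.chain k).Sorts) j.succ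
  lhs := .top
  rhs := .ex (.graph i X 1 0 rfl rfl)

/-- The context `x₁, …, xₐ, y₁, …, yₐ` of two tuples of arguments of `R`, in the copies `i` and
`i + 1`. -/
def relCtx (i : Fin k) (R : L.Rels) : Fin (L.arity R + L.arity R) → (L.chain k).Sorts :=
  Fin.append (fun j => (i.castSucc, L.dom R j)) (fun j => (i.succ, L.dom R j))

theorem relCtx_left (i : Fin k) (R : L.Rels) (j : Fin (L.arity R)) :
    relCtx i R (Fin.castAdd _ j) = (i.castSucc, L.dom R j) := Fin.append_left _ _ j

theorem relCtx_right (i : Fin k) (R : L.Rels) (j : Fin (L.arity R)) :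
    relCtx i R (Fin.natAdd _ j) = (i.succ, L.dom R j) := Fin.append_right _ _ j

/-- The formula `⋀ⱼ (xⱼ, yⱼ) ∈ αᵢ`. -/
def relGraph (i : Fin k) (R : L.Rels) : Formula.{u, w} (L.chain k) _ (relCtx i R) :=
  .conj fun j => .graph i (L.dom R j) (Fin.castAdd _ j) (Fin.natAdd _ j)
    (relCtx_left i R j) (relCtx_right i R j)

/-- The formula `⋀ⱼ (xⱼ, yⱼ) ∈ αᵢ ∧ (x₁, …, xₐ) ∈ Rᵢ`. -/
def relLeft (i : Fin k) (R : L.Rels) : Formula.{u, w} (L.chain k) _ (relCtx i R) :=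
  (relGraph i R).and
    (.rel (L := L.chain k) (.inl (i.castSucc, R)) (fun j => Fin.castAdd _ j) (relCtx_left i R))

/-- The formula `⋀ⱼ (xⱼ, yⱼ) ∈ αᵢ ∧ (y₁, …, yₐ) ∈ Rᵢ₊₁`. -/
def relRight (i : Fin k) (R : L.Rels) : Formula.{u, w} (L.chain k) _ (relCtx i R) :=
  (relGraph i R).and
    (.rel (L := L.chain k) (.inl (i.succ, R)) (fun j => Fin.natAdd _ j) (relCtx_right i R))

end chain

/-- The axioms of the theory of chains of isomorphisms of models. -/
inductive GeomTheory.ChainAxiom (T : GeomTheory.{u, w}) (k : ℕ) : Sequent.{u, w} (T.sig.chain k) → Prop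
  | copy (c : Fin (k + 1)) (σ : Sequent.{u, w} T.sig) (hσ : σ ∈ T.axioms) :
      ChainAxiom T k (σ.copy c)
  | fun_ (i : Fin k) (X : T.sig.Sorts) : ChainAxiom T k ⟨4, _, pairEqLeft i X, pairEqRight i X⟩
  | inj (i : Fin k) (X : T.sig.Sorts) : ChainAxiom T k ⟨4, _, pairEqRight i X, pairEqLeft i X⟩
  | surj (i : Fin k) (X : T.sig.Sorts) : ChainAxiom T k (surjSeq i X)
  | total (i : Fin k) (X : T.sig.Sorts) : ChainAxiom T k (totalSeq i X)
  | relMap (i : Fin k) (R : T.sig.Rels) : ChainAxiom T k ⟨_, _, relLeft i R, relRight i R⟩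
  | relComap (i : Fin k) (R : T.sig.Rels) : ChainAxiom T k ⟨_, _, relRight i R, relLeft i R⟩

/-- The geometric theory of chains `M₀ ≅ M₁ ≅ … ≅ Mₖ` of `k` isomorphisms between `k + 1` models
of `T`. For `k = 1` it is the theory of isomorphisms of models of `T`, for `k = 2` that of
composable pairs of isomorphisms. -/
abbrev GeomTheory.chain (T : GeomTheory.{u, w}) (k : ℕ) : GeomTheory.{u, w} where
  sig := T.sig.chain k
  axioms := {σ | T.ChainAxiom k σ}

/-! ### Models in frames -/

section models

variable {L : Signature.{u}} {F : Type v} [Frame F] {E : Type v'} [Frame E]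

theorem map_iInf_fin (f : FrameHom E F) {k : ℕ} (a : Fin k → E) :
    f (⨅ j, a j) = ⨅ j, f (a j) := by
  rw [← Finset.inf_univ_eq_iInf, ← Finset.inf_univ_eq_iInf, map_finset_inf]
  rfl

/-- The image of an assignment under a frame homomorphism. -/
def Interp.map (f : FrameHom E F) (M : Interp L E) : Interp L F where
  sim X n m := f (M.sim X n m)
  mem R n := f (M.mem R n)

theorem Formula.val_map (f : FrameHom E F) (M : Interp L E) {n : ℕ} {Γ : Fin n → L.Sorts}
    (φ : Formula.{u, w} L n Γ) (ν : Fin n → ℕ) : φ.val (M.map f) ν = f (φ.val M ν) := by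
  induction φ with
  | rel R x h => rfl
  | eq i j h => rfl
  | conj φ ih => simp only [Formula.val, map_iInf_fin, ih]
  | disj φ ih => simp only [Formula.val, map_iSup, ih]
  | ex φ ih => simp only [Formula.val, map_iSup, map_inf, ih]; rfl

/-- The assignment `M` is a model of `P[T]`. -/
def Interp.IsModel (T : GeomTheory.{u, w}) (M : Interp T.sig F) : Prop :=
  ∀ a b, T.PropAxiom M a b → a ≤ b

theorem GeomTheory.PropAxiom.map {T : GeomTheory.{u, w}} (f : FrameHom E F) {M : Interp T.sig E}
    {a b : E} (h : T.PropAxiom M a b) : T.PropAxiom (M.map f) (f a) (f b) := by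
  induction h with
  | symm X n m => exact .symm (M := M.map f) X n m
  | trans X n m l => rw [map_inf]; exact .trans (M := M.map f) X n m l
  | congr R n m => rw [map_inf, map_iInf_fin]; exact .congr (M := M.map f) R n m
  | strict R n => rw [map_iInf_fin]; exact .strict (M := M.map f) R n
  | ax σ hσ ν =>
    rw [map_inf, map_iInf_fin, ← Formula.val_map, ← Formula.val_map]
    exact .ax (M := M.map f) σ hσ ν

theorem GeomTheory.PropAxiom.of_map {T : GeomTheory.{u, w}} (f : FrameHom E F)
    {M : Interp T.sig E} {a b : F} (h : T.PropAxiom (M.map f) a b) :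
    ∃ a' b', T.PropAxiom M a' b' ∧ f a' = a ∧ f b' = b := by
  induction h with
  | symm X n m => exact ⟨_, _, .symm X n m, rfl, rfl⟩
  | trans X n m l => exact ⟨_, _, .trans X n m l, map_inf f _ _, rfl⟩
  | congr R n m =>
    exact ⟨_, _, .congr R n m, (map_inf f _ _).trans (congrArg _ (map_iInf_fin f _)), rfl⟩
  | strict R n => exact ⟨_, _, .strict R n, rfl, map_iInf_fin f _⟩
  | ax σ hσ ν =>
    refine ⟨_, _, .ax σ hσ ν, ?_, (Formula.val_map f M _ _).symm⟩
    rw [map_inf, map_iInf_fin, ← Formula.val_map]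
    rfl

theorem Interp.IsModel.map {T : GeomTheory.{u, w}} {M : Interp T.sig E} (h : M.IsModel T)
    (f : FrameHom E F) : (M.map f).IsModel T := by
  intro a b hab
  obtain ⟨a', b', h', rfl, rfl⟩ := hab.of_map
  exact OrderHomClass.mono f (h _ _ h')

variable (T : GeomTheory.{u, w})

/-- The generic model of `P[T]`. -/
def GeomTheory.generic : Interp T.sig T.P.frame where
  sim X n m := T.P.gen (.sim X n m)
  mem R n := T.P.gen (.mem R n)

theorem GeomTheory.generic_isModel : T.generic.IsModel T := by
  intro a b hab
  obtain ⟨a', b', h', rfl, rfl⟩ :=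
    GeomTheory.PropAxiom.of_map (M := Interp.free T.sig) T.P.nucleus.restrict hab
  exact T.P.restrict_le (r := (a', b')) h'

variable {T}

/-- The value of a basic proposition. -/
def Interp.basic (M : Interp L F) : BasicProp L → F
  | .sim X n m => M.sim X n m
  | .mem R n => M.mem R n

theorem Interp.map_free (M : Interp L F) : (Interp.free L).map (FreeFrame.lift M.basic) = M := by
  ext
  · exact FreeFrame.lift_of _ _
  · exact FreeFrame.lift_of _ _

/-- The frame homomorphism that classifies a model of `P[T]`. -/
def Interp.IsModel.hom {M : Interp T.sig F} (h : M.IsModel T) : FrameHom T.P.frame F :=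
  Presentation.lift M.basic fun r hr => by
    have := GeomTheory.PropAxiom.map (FreeFrame.lift M.basic) (M := Interp.free T.sig) hr
    rw [M.map_free] at this
    exact h _ _ this

theorem Interp.IsModel.map_hom {M : Interp T.sig F} (h : M.IsModel T) :
    T.generic.map h.hom = M := by
  ext
  · exact Presentation.lift_gen _ _ _
  · exact Presentation.lift_gen _ _ _

theorem Interp.hom_ext {f g : FrameHom T.P.frame F} (h : T.generic.map f = T.generic.map g) :
    f = g := by
  refine Presentation.hom_ext fun x => ?_
  cases x with
  | sim X n m => exact congrArg (fun M => M.sim X n m) h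
  | mem R n => exact congrArg (fun M => M.mem R n) h

theorem Interp.map_map {D : Type*} [Frame D] (M : Interp L D) (f : FrameHom D E)
    (g : FrameHom E F) : (M.map f).map g = M.map (g.comp f) := rfl

end models

section chainModels

variable {L : Signature.{u}} {k : ℕ} {F : Type v} [Frame F]

/-- The assignment for a chain, given by assignments `M₀, …, Mₖ` and by `F`-valued relations
`α₀, …, αₖ₋₁`. -/
def Interp.chain (M : Fin (k + 1) → Interp L F) (α : Fin k → L.Sorts → ℕ → ℕ → F) :
    Interp (L.chain k) F where
  sim X n m := (M X.1).sim X.2 n m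
  mem R := match R with
    | .inl R => fun n => (M R.1).mem R.2 n
    | .inr a => fun n : Fin 2 → ℕ => α a.1 a.2 (n 0) (n 1)

/-- The `c`-th member of a chain. -/
def Interp.copy (c : Fin (k + 1)) (N : Interp (L.chain k) F) : Interp L F where
  sim X n m := N.sim (c, X) n m
  mem R n := N.mem (.inl (c, R)) n

/-- The `i`-th relation of a chain. -/
def Interp.graph (i : Fin k) (N : Interp (L.chain k) F) (X : L.Sorts) (n m : ℕ) : F :=
  N.mem (.inr (i, X)) ![n, m]

theorem Interp.chain_eta (N : Interp (L.chain k) F) :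
    Interp.chain (fun c => N.copy c) (fun i => N.graph i) = N := by
  refine Interp.ext rfl (funext fun R => ?_)
  · cases R with
    | inl R => rfl
    | inr a =>
      refine funext fun n => ?_
      change N.mem (.inr a) ![n (0 : Fin 2), n (1 : Fin 2)] = N.mem (.inr a) n
      congr 1
      ext j
      exact Fin.cases rfl (fun j => Fin.cases rfl (fun j => j.elim0) j) j

theorem Formula.val_copy (N : Interp (L.chain k) F) (c : Fin (k + 1)) {n : ℕ}
    {Γ : Fin n → L.Sorts} (φ : Formula.{u, w} L n Γ) (ν : Fin n → ℕ) :
    (φ.copy c).val N ν = φ.val (N.copy c) ν := by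
  induction φ with
  | rel R x h => rfl
  | eq i j h => rfl
  | conj φ ih => simp only [Formula.copy, Formula.val, ih]
  | disj φ ih => simp only [Formula.copy, Formula.val, ih]
  | ex φ ih => simp only [Formula.copy, Formula.val, ih]; rfl

/-- `α` is an `F`-valued isomorphism from `M` to `N`. -/
structure Interp.IsIso (M N : Interp L F) (α : L.Sorts → ℕ → ℕ → F) : Prop where
  left : ∀ X n m, α X n m ≤ M.sim X n n
  right : ∀ X n m, α X n m ≤ N.sim X m m
  congr : ∀ X n m n' m', α X n m ⊓ (M.sim X n n' ⊓ N.sim X m m') ≤ α X n' m'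
  fun_ : ∀ X n m n' m', α X n m ⊓ α X n' m' ⊓ M.sim X n n' ≤ N.sim X m m'
  inj : ∀ X n m n' m', α X n m ⊓ α X n' m' ⊓ N.sim X m m' ≤ M.sim X n n'
  surj : ∀ X m, N.sim X m m ≤ ⨆ n, α X n m
  total : ∀ X n, M.sim X n n ≤ ⨆ m, α X n m
  relMap : ∀ (R : L.Rels) (x y : Fin (L.arity R) → ℕ),
    (⨅ j, α (L.dom R j) (x j) (y j)) ⊓ M.mem R x ≤ N.mem R y
  relComap : ∀ (R : L.Rels) (x y : Fin (L.arity R) → ℕ),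
    (⨅ j, α (L.dom R j) (x j) (y j)) ⊓ N.mem R y ≤ M.mem R x

theorem iInf_two (a : Fin 2 → F) : ⨅ j, a j = a 0 ⊓ a 1 := by
  refine le_antisymm (le_inf (iInf_le _ _) (iInf_le _ _)) (le_iInf fun j => ?_)
  exact Fin.cases inf_le_left (fun j => Fin.cases inf_le_right (fun j => j.elim0) j) j

theorem Formula.val_and (M : Interp L F) {n : ℕ} {Γ : Fin n → L.Sorts}
    (φ ψ : Formula.{u, w} L n Γ) (ν : Fin n → ℕ) :
    (φ.and ψ).val M ν = φ.val M ν ⊓ ψ.val M ν := by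
  simp only [Formula.and, Formula.val]
  exact iInf_two _

theorem Formula.val_graph (N : Interp (L.chain k) F) {n : ℕ} {Γ : Fin n → (L.chain k).Sorts}
    (i : Fin k) (X : L.Sorts) (x y : Fin n) (hx : Γ x = (i.castSucc, X)) (hy : Γ y = (i.succ, X))
    (ν : Fin n → ℕ) :
    (Formula.graph.{u, w} i X x y hx hy).val N ν = N.graph i X (ν x) (ν y) := by
  simp only [Formula.graph, Formula.val, Interp.graph]
  congr 1
  ext j
  exact Fin.cases rfl (fun j => Fin.cases rfl (fun j => j.elim0) j) j

theorem val_pairEqLeft (N : Interp (L.chain k) F) (i : Fin k) (X : L.Sorts) (ν : Fin 4 → ℕ) :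
    (pairEqLeft.{u, w} i X).val N ν = N.graph i X (ν 0) (ν 2) ⊓ N.graph i X (ν 1) (ν 3) ⊓
      (N.copy i.castSucc).sim X (ν 0) (ν 1) :=
  (Formula.val_and ..).trans (congrArg₂ _ ((Formula.val_and ..).trans
    (congrArg₂ _ (Formula.val_graph ..) (Formula.val_graph ..))) rfl)

theorem val_pairEqRight (N : Interp (L.chain k) F) (i : Fin k) (X : L.Sorts) (ν : Fin 4 → ℕ) :
    (pairEqRight.{u, w} i X).val N ν = N.graph i X (ν 0) (ν 2) ⊓ N.graph i X (ν 1) (ν 3) ⊓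
      (N.copy i.succ).sim X (ν 2) (ν 3) :=
  (Formula.val_and ..).trans (congrArg₂ _ ((Formula.val_and ..).trans
    (congrArg₂ _ (Formula.val_graph ..) (Formula.val_graph ..))) rfl)

theorem val_surj (N : Interp (L.chain k) F) (i : Fin k) (X : L.Sorts) (ν : Fin 1 → ℕ) :
    (surjSeq.{u, w} i X).rhs.val N ν =
      ⨆ n, (N.copy i.castSucc).sim X n n ⊓ N.graph i X n (ν 0) :=
  iSup_congr fun _ => congrArg₂ _ rfl (Formula.val_graph ..)

theorem val_total (N : Interp (L.chain k) F) (i : Fin k) (X : L.Sorts) (ν : Fin 1 → ℕ) :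
    (totalSeq.{u, w} i X).rhs.val N ν =
      ⨆ m, (N.copy i.succ).sim X m m ⊓ N.graph i X (ν 0) m :=
  iSup_congr fun _ => congrArg₂ _ rfl (Formula.val_graph ..)

theorem val_relLeft (N : Interp (L.chain k) F) (i : Fin k) (R : L.Rels) (ν : _ → ℕ) :
    (relLeft.{u, w} i R).val N ν =
      (⨅ j, N.graph i (L.dom R j) (ν (Fin.castAdd _ j)) (ν (Fin.natAdd _ j))) ⊓
        (N.copy i.castSucc).mem R (fun j => ν (Fin.castAdd _ j)) :=
  (Formula.val_and ..).trans
    (congrArg₂ _ (iInf_congr fun _ => Formula.val_graph ..) rfl)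

theorem val_relRight (N : Interp (L.chain k) F) (i : Fin k) (R : L.Rels) (ν : _ → ℕ) :
    (relRight.{u, w} i R).val N ν =
      (⨅ j, N.graph i (L.dom R j) (ν (Fin.castAdd _ j)) (ν (Fin.natAdd _ j))) ⊓
        (N.copy i.succ).mem R (fun j => ν (Fin.natAdd _ j)) :=
  (Formula.val_and ..).trans
    (congrArg₂ _ (iInf_congr fun _ => Formula.val_graph ..) rfl)

variable {T : GeomTheory.{u, w}}

theorem Interp.IsModel.copy {N : Interp (T.sig.chain k) F} (h : Interp.IsModel (T.chain k) N)
    (c : Fin (k + 1)) : (Interp.copy c N).IsModel T := by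
  intro a b hab
  induction hab with
  | symm X n m => exact h _ _ (.symm (T := T.chain k) (c, X) n m)
  | trans X n m l => exact h _ _ (.trans (T := T.chain k) (c, X) n m l)
  | congr R n m => exact h _ _ (.congr (T := T.chain k) (.inl (c, R)) n m)
  | strict R n => exact h _ _ (.strict (T := T.chain k) (.inl (c, R)) n)
  | ax σ hσ ν =>
    have := h _ _ (.ax (T := T.chain k) (σ.copy c) (.copy c σ hσ) ν)
    exact (inf_le_inf le_rfl (Formula.val_copy N c σ.lhs ν).ge).trans
      (this.trans (Formula.val_copy N c σ.rhs ν).le)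

theorem Interp.IsModel.isIso {N : Interp (T.sig.chain k) F} (h : Interp.IsModel (T.chain k) N)
    (i : Fin k) :
    Interp.IsIso (N.copy i.castSucc) (N.copy i.succ)
      (N.graph i) := by
  have strict : ∀ (X : T.sig.Sorts) n m, N.graph i X n m ≤
      N.sim (i.castSucc, X) n n ⊓ N.sim (i.succ, X) m m := fun X n m => by
    have := h _ _ (.strict (T := T.chain k) (.inr (i, X)) ![n, m])
    exact this.trans (iInf_two _).le
  have pair : ∀ (X : T.sig.Sorts) n n' m m',
      N.graph i X n m ⊓ N.graph i X n' m' ≤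
      ⨅ j, N.sim (pairCtx T.sig i X j) (![n, n', m, m'] j) (![n, n', m, m'] j) := by
    intro X n n' m m'
    have h1 := (inf_le_left (b := N.graph i X n' m')).trans (strict X n m)
    have h2 := (inf_le_right (a := N.graph i X n m)).trans (strict X n' m')
    refine le_iInf fun j => ?_
    fin_cases j
    · exact h1.trans inf_le_left
    · exact h2.trans inf_le_left
    · exact h1.trans inf_le_right
    · exact h2.trans inf_le_right
  have relc : ∀ (R : T.sig.Rels) (x y : Fin (T.sig.arity R) → ℕ),
      (⨅ j, N.graph i (T.sig.dom R j) (x j) (y j)) ≤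
      ⨅ j, N.sim (relCtx i R j) (Fin.append x y j) (Fin.append x y j) := by
    intro R x y
    refine le_iInf fun j => ?_
    induction j using Fin.addCases with
    | left j =>
      rw [relCtx_left, Fin.append_left]
      exact (iInf_le _ j).trans ((strict _ _ _).trans inf_le_left)
    | right j =>
      rw [relCtx_right, Fin.append_right]
      exact (iInf_le _ j).trans ((strict _ _ _).trans inf_le_right)
  refine ⟨?_, ?_, ?_, ?_, ?_, ?_, ?_, ?_, ?_⟩
  · exact fun X n m => (strict X n m).trans inf_le_left
  · exact fun X n m => (strict X n m).trans inf_le_right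
  · intro X n m n' m'
    have := h _ _ (.congr (T := T.chain k) (.inr (i, X)) ![n, m] ![n', m'])
    exact (inf_le_inf le_rfl (iInf_two _).ge).trans this
  · intro X n m n' m'
    have := h _ _ (.ax (T := T.chain k) _ (.fun_ i X) ![n, n', m, m'])
    exact (le_inf (inf_le_left.trans (pair X n n' m m'))
      (val_pairEqLeft N i X ![n, n', m, m']).ge).trans
      (this.trans ((val_pairEqRight ..).le.trans inf_le_right))
  · intro X n m n' m'
    have := h _ _ (.ax (T := T.chain k) _ (.inj i X) ![n, n', m, m'])
    exact (le_inf (inf_le_left.trans (pair X n n' m m'))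
      (val_pairEqRight N i X ![n, n', m, m']).ge).trans
      (this.trans ((val_pairEqLeft ..).le.trans inf_le_right))
  · intro X m
    have := h _ _ (.ax (T := T.chain k) _ (.surj i X) ![m])
    refine le_trans (le_inf (le_iInf fun j => ?_) (le_iInf fun j => j.elim0)) (this.trans ?_)
    · exact Fin.cases le_rfl (fun j => j.elim0) j
    · refine (val_surj ..).le.trans ?_
      exact iSup_mono fun n => inf_le_right
  · intro X m
    have := h _ _ (.ax (T := T.chain k) _ (.total i X) ![m])
    refine le_trans (le_inf (le_iInf fun j => ?_) (le_iInf fun j => j.elim0)) (this.trans ?_)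
    · exact Fin.cases le_rfl (fun j => j.elim0) j
    · refine (val_total ..).le.trans ?_
      exact iSup_mono fun n => inf_le_right
  · intro R x y
    have := h _ _ (.ax (T := T.chain k) _ (.relMap i R) (Fin.append x y))
    have hl := val_relLeft.{u, w} N i R (Fin.append x y)
    have hr := val_relRight.{u, w} N i R (Fin.append x y)
    simp only [Fin.append_left, Fin.append_right] at hl hr
    exact (le_inf (inf_le_left.trans (relc R x y)) hl.ge).trans
      (this.trans (hr.le.trans inf_le_right))
  · intro R x y
    have := h _ _ (.ax (T := T.chain k) _ (.relComap i R) (Fin.append x y))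
    have hl := val_relLeft.{u, w} N i R (Fin.append x y)
    have hr := val_relRight.{u, w} N i R (Fin.append x y)
    simp only [Fin.append_left, Fin.append_right] at hl hr
    exact (le_inf (inf_le_left.trans (relc R x y)) hr.ge).trans
      (this.trans (hl.le.trans inf_le_right))

theorem Interp.IsModel.mk_chain {N : Interp (T.sig.chain k) F}
    (hM : ∀ c, (Interp.copy c N).IsModel T)
    (hα : ∀ i : Fin k, Interp.IsIso (N.copy i.castSucc)
      (N.copy i.succ) (N.graph i)) :
    Interp.IsModel (T.chain k) N := by
  have eta : ∀ (a : Fin k × T.sig.Sorts) (n : Fin 2 → ℕ),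
      N.mem (.inr a) n = N.graph a.1 a.2 (n 0) (n 1) := fun a n => by
    conv_lhs => rw [← Interp.chain_eta N]
    rfl
  intro a b hab
  cases hab with
  | symm X n m => exact hM X.1 _ _ (.symm X.2 n m)
  | trans X n m l => exact hM X.1 _ _ (.trans X.2 n m l)
  | congr R n m =>
    cases R with
    | inl R => exact hM R.1 _ _ (.congr R.2 n m)
    | inr a =>
      exact ((inf_le_inf (eta a n).le (iInf_two _).le).trans
        ((hα a.1).congr a.2 _ _ _ _)).trans (eta a m).ge
  | strict R n =>
    cases R with
    | inl R => exact hM R.1 _ _ (.strict R.2 n)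
    | inr a =>
      refine (eta a n).le.trans (le_trans (le_inf ?_ ?_) (iInf_two _).ge)
      · exact (hα a.1).left _ _ _
      · exact (hα a.1).right _ _ _
  | ax σ hσ ν =>
    cases hσ with
    | copy c σ hσ =>
      exact (inf_le_inf le_rfl (Formula.val_copy N c σ.lhs ν).le).trans
        ((hM c _ _ (.ax σ hσ ν)).trans (Formula.val_copy N c σ.rhs ν).ge)
    | fun_ i X =>
      exact inf_le_right.trans ((val_pairEqLeft ..).le.trans
        ((le_inf inf_le_left ((hα i).fun_ X _ _ _ _)).trans (val_pairEqRight ..).ge))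
    | inj i X =>
      exact inf_le_right.trans ((val_pairEqRight ..).le.trans
        ((le_inf inf_le_left ((hα i).inj X _ _ _ _)).trans (val_pairEqLeft ..).ge))
    | surj i X =>
      change Fin 1 → ℕ at ν
      refine inf_le_left.trans ((iInf_le _ (0 : Fin 1)).trans (((hα i).surj X (ν 0)).trans
        (le_trans ?_ (val_surj N i X ν).ge)))
      exact iSup_mono fun n => le_inf ((hα i).left X _ _) le_rfl
    | total i X =>
      change Fin 1 → ℕ at ν
      refine inf_le_left.trans ((iInf_le _ (0 : Fin 1)).trans (((hα i).total X (ν 0)).trans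
        (le_trans ?_ (val_total N i X ν).ge)))
      exact iSup_mono fun n => le_inf ((hα i).right X _ _) le_rfl
    | relMap i R =>
      exact inf_le_right.trans ((val_relLeft ..).le.trans
        ((le_inf inf_le_left ((hα i).relMap R _ _)).trans (val_relRight ..).ge))
    | relComap i R =>
      exact inf_le_right.trans ((val_relRight ..).le.trans
        ((le_inf inf_le_left ((hα i).relComap R _ _)).trans (val_relLeft ..).ge))

end chainModels

/-! ### Groupoids -/

/-- An internal groupoid in a category. The object `G₂` of composable pairs is the pullback of the
target map along the source map, and `m` composes in diagrammatic order: the first arrow of a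
composable pair is applied first. -/
structure InternalGroupoid (C : Type u) [Category.{v} C] where
  /-- The object of objects. -/
  G₀ : C
  /-- The object of arrows. -/
  G₁ : C
  /-- The object of composable pairs of arrows. -/
  G₂ : C
  /-- The source. -/
  s : G₁ ⟶ G₀
  /-- The target. -/
  t : G₁ ⟶ G₀
  /-- The identities. -/
  e : G₀ ⟶ G₁
  /-- The inversion. -/
  i : G₁ ⟶ G₁
  /-- The first arrow of a composable pair. -/
  p₁ : G₂ ⟶ G₁
  /-- The second arrow of a composable pair. -/
  p₂ : G₂ ⟶ G₁
  /-- The composition. -/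
  m : G₂ ⟶ G₁
  isPullback : IsPullback p₁ p₂ t s
  e_s : e ≫ s = 𝟙 G₀
  e_t : e ≫ t = 𝟙 G₀
  m_s : m ≫ s = p₁ ≫ s
  m_t : m ≫ t = p₂ ≫ t
  i_s : i ≫ s = t
  i_t : i ≫ t = s
  i_i : i ≫ i = 𝟙 G₁
  id_comp : isPullback.lift (s ≫ e) (𝟙 G₁)
    (by rw [Category.assoc, e_t, Category.comp_id, Category.id_comp]) ≫ m = 𝟙 G₁
  comp_id : isPullback.lift (𝟙 G₁) (t ≫ e)
    (by rw [Category.assoc, e_s, Category.comp_id, Category.id_comp]) ≫ m = 𝟙 G₁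
  comp_inv : isPullback.lift (𝟙 G₁) i (by rw [i_s, Category.id_comp]) ≫ m = s ≫ e
  inv_comp : isPullback.lift i (𝟙 G₁) (by rw [i_t, Category.id_comp]) ≫ m = t ≫ e
  assoc : ∀ {U : C} (f g h : U ⟶ G₁) (hfg : f ≫ t = g ≫ s) (hgh : g ≫ t = h ≫ s),
    isPullback.lift (isPullback.lift f g hfg ≫ m) h
        (by rw [Category.assoc, m_t, ← Category.assoc, isPullback.lift_snd, hgh]) ≫ m =
      isPullback.lift f (isPullback.lift g h hgh ≫ m)
        (by rw [Category.assoc, m_s, ← Category.assoc, isPullback.lift_fst, hfg]) ≫ m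

/-- A localic groupoid. -/
abbrev LocalicGroupoid := InternalGroupoid Locale.{u}

/-- A topological groupoid. -/
abbrev TopologicalGroupoid := InternalGroupoid TopCat.{u}

/-- The localic groupoid `G` arises from the topological groupoid `H`: the diagram `G` of locales
is isomorphic to the diagram of the locales of open sets of the spaces in `H`. -/
def LocalicGroupoid.ArisesFrom (G : LocalicGroupoid.{u}) (H : TopologicalGroupoid.{u}) : Prop :=
  ∃ (f₀ : topToLocale.obj H.G₀ ≅ G.G₀) (f₁ : topToLocale.obj H.G₁ ≅ G.G₁)
    (f₂ : topToLocale.obj H.G₂ ≅ G.G₂),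
    topToLocale.map H.s ≫ f₀.hom = f₁.hom ≫ G.s ∧
    topToLocale.map H.t ≫ f₀.hom = f₁.hom ≫ G.t ∧
    topToLocale.map H.e ≫ f₁.hom = f₀.hom ≫ G.e ∧
    topToLocale.map H.i ≫ f₁.hom = f₁.hom ≫ G.i ∧
    topToLocale.map H.p₁ ≫ f₁.hom = f₂.hom ≫ G.p₁ ∧
    topToLocale.map H.p₂ ≫ f₁.hom = f₂.hom ≫ G.p₂ ∧
    topToLocale.map H.m ≫ f₁.hom = f₂.hom ≫ G.m

/-- A locale is spatial if it is the locale of open sets of a topological space. -/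
def IsSpatial (X : Locale.{u}) : Prop :=
  ∃ S : TopCat.{u}, Nonempty (topToLocale.obj S ≅ X)

/-- A locale is countably presented if its frame of opens has a presentation with countably many
generators and countably many relations. -/
def IsCountablyPresented (X : Locale.{u}) : Prop :=
  ∃ P : Presentation.{u}, Countable P.Gen ∧ P.rel.Countable ∧ Nonempty (X ≅ P.locale)

/-! ### The localic groupoid of a geometric theory -/

section isos

variable {L : Signature.{u}} {F : Type v} [Frame F]

/-- The composite of two `F`-valued relations. -/
def relComp (α β : L.Sorts → ℕ → ℕ → F) (X : L.Sorts) (n p : ℕ) : F :=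
  ⨆ m, α X n m ⊓ β X m p

/-- `M` satisfies the axioms of partial equivalence relations and of compatible relations. -/
structure Interp.IsStr (M : Interp L F) : Prop where
  symm : ∀ X n m, M.sim X n m ≤ M.sim X m n
  trans : ∀ X n m l, M.sim X n m ⊓ M.sim X m l ≤ M.sim X n l
  congr : ∀ (R : L.Rels) (n m : Fin (L.arity R) → ℕ),
    M.mem R n ⊓ ⨅ j, M.sim (L.dom R j) (n j) (m j) ≤ M.mem R m

theorem Interp.IsModel.isStr {T : GeomTheory.{u, w}} {M : Interp T.sig F} (h : M.IsModel T) :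
    M.IsStr where
  symm X n m := h _ _ (.symm X n m)
  trans X n m l := h _ _ (.trans X n m l)
  congr R n m := h _ _ (.congr R n m)

variable {M N Q : Interp L F} {α β : L.Sorts → ℕ → ℕ → F}

theorem Interp.IsStr.diag (h : M.IsStr) (X : L.Sorts) (n m : ℕ) :
    M.sim X n m ≤ M.sim X n n :=
  (le_inf le_rfl (h.symm X n m)).trans (h.trans X n m n)

theorem Interp.IsStr.diag' (h : M.IsStr) (X : L.Sorts) (n m : ℕ) :
    M.sim X n m ≤ M.sim X m m :=
  (h.symm X n m).trans (h.diag X m n)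

theorem Interp.IsIso.refl (h : M.IsStr) : Interp.IsIso M M M.sim where
  left := h.diag
  right := h.diag'
  congr X n m n' m' :=
    le_trans (le_inf (inf_le_right.trans inf_le_left |>.trans (h.symm X n n'))
      ((inf_le_inf le_rfl inf_le_right).trans (h.trans X n m m'))) (h.trans X n' n m')
  fun_ X n m n' m' :=
    le_trans (le_inf ((inf_le_left.trans inf_le_left).trans (h.symm X n m))
      (le_trans (le_inf inf_le_right (inf_le_left.trans inf_le_right)) (h.trans X n n' m')))
      (h.trans X m n m')
  inj X n m n' m' :=
    le_trans (le_inf (inf_le_left.trans inf_le_left)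
      (le_trans (le_inf inf_le_right ((inf_le_left.trans inf_le_right).trans (h.symm X n' m')))
        (h.trans X m m' n'))) (h.trans X n m n')
  surj X m := le_iSup (fun n => M.sim X n m) m
  total X n := le_iSup (fun m => M.sim X n m) n
  relMap R x y := le_trans (le_inf inf_le_right inf_le_left) (h.congr R x y)
  relComap R x y := le_trans (le_inf inf_le_right
    (inf_le_left.trans (iInf_mono fun _ => h.symm _ _ _))) (h.congr R y x)

theorem Interp.IsIso.symm (h : Interp.IsIso M N α) :
    Interp.IsIso N M (fun X n m => α X m n) where
  left X n m := h.right X m n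
  right X n m := h.left X m n
  congr X n m n' m' :=
    (inf_le_inf le_rfl (inf_comm _ _).le).trans (h.congr X m n m' n')
  fun_ X n m n' m' := h.inj X m n m' n'
  inj X n m n' m' := h.fun_ X m n m' n'
  surj := h.total
  total := h.surj
  relMap R x y := h.relComap R y x
  relComap R x y := h.relMap R y x

theorem iInf_iSup_inf_le {k : ℕ} (f : Fin k → ℕ → F) (a b : F)
    (h : ∀ s : Fin k → ℕ, (⨅ j, f j (s j)) ⊓ a ≤ b) : (⨅ j, ⨆ m, f j m) ⊓ a ≤ b := by
  induction k generalizing a with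
  | zero =>
    refine (inf_le_right.trans (le_inf (le_iInf fun j => j.elim0) le_rfl)).trans (h Fin.elim0)
  | succ k ih =>
    have h1 : (⨅ j, ⨆ m, f j m) ≤ (⨅ j : Fin k, ⨆ m, f j.succ m) ⊓ ⨆ m, f 0 m :=
      le_inf (le_iInf fun j => iInf_le _ j.succ) (iInf_le _ 0)
    refine (inf_le_inf h1 le_rfl).trans ?_
    rw [inf_assoc]
    refine ih (fun j => f j.succ) _ fun s => ?_
    rw [iSup_inf_eq, inf_iSup_eq]
    refine iSup_le fun m => le_trans (le_inf (le_iInf fun j => ?_) ?_) (h (Fin.cons m s))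
    · refine Fin.cases ?_ (fun j => ?_) j
      · exact inf_le_right.trans inf_le_left
      · exact inf_le_left.trans (iInf_le _ j)
    · exact inf_le_right.trans inf_le_right

theorem Interp.IsIso.relComp_fun (hα : Interp.IsIso M N α) (hβ : Interp.IsIso N Q β)
    (X : L.Sorts) (n m n' m' : ℕ) :
    relComp α β X n m ⊓ relComp α β X n' m' ⊓ M.sim X n n' ≤ Q.sim X m m' := by
  rw [relComp, relComp, iSup_inf_iSup, iSup_inf_eq]
  refine iSup_le fun a => ?_
  have h1 := hα.fun_ X n a.1 n' a.2
  have h2 := hβ.fun_ X a.1 m a.2 m'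
  refine le_trans (le_inf (le_inf ?_ ?_) (le_trans (le_inf (le_inf ?_ ?_) ?_) h1)) h2
  · exact inf_le_left.trans (inf_le_left.trans inf_le_right)
  · exact inf_le_left.trans (inf_le_right.trans inf_le_right)
  · exact inf_le_left.trans (inf_le_left.trans inf_le_left)
  · exact inf_le_left.trans (inf_le_right.trans inf_le_left)
  · exact inf_le_right

theorem relComp_symm (X : L.Sorts) (n m : ℕ) :
    relComp α β X n m = relComp (fun X n m => β X m n) (fun X n m => α X m n) X m n :=
  iSup_congr fun _ => inf_comm _ _

theorem Interp.IsIso.relComp_map (hα : Interp.IsIso M N α) (hβ : Interp.IsIso N Q β)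
    (R : L.Rels) (x y : Fin (L.arity R) → ℕ) :
    (⨅ j, relComp α β (L.dom R j) (x j) (y j)) ⊓ M.mem R x ≤ Q.mem R y := by
  refine iInf_iSup_inf_le _ _ _ fun s => ?_
  refine le_trans (le_inf (inf_le_left.trans (iInf_mono fun j => inf_le_right)) ?_)
    (hβ.relMap R s y)
  exact le_trans (inf_le_inf (iInf_mono fun j => inf_le_left) le_rfl) (hα.relMap R x s)

theorem Interp.IsIso.relComp_total (hα : Interp.IsIso M N α) (hβ : Interp.IsIso N Q β)
    (X : L.Sorts) (n : ℕ) : M.sim X n n ≤ ⨆ m, relComp α β X n m := by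
  refine (hα.total X n).trans (iSup_le fun m => ?_)
  refine (le_inf le_rfl ((hα.right X n m).trans (hβ.total X m))).trans ?_
  rw [inf_iSup_eq]
  exact iSup_mono fun p => le_iSup (fun m => α X n m ⊓ β X m p) m

theorem Interp.IsIso.comp (hα : Interp.IsIso M N α) (hβ : Interp.IsIso N Q β) :
    Interp.IsIso M Q (relComp α β) where
  left X n m := iSup_le fun a => inf_le_left.trans (hα.left X n a)
  right X n m := iSup_le fun a => inf_le_right.trans (hβ.right X a m)
  congr X n m n' m' := by
    rw [relComp, iSup_inf_eq]
    refine iSup_le fun a => le_iSup_of_le a (le_inf ?_ ?_)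
    · refine le_trans (le_inf (inf_le_left.trans inf_le_left)
        (le_inf (inf_le_right.trans inf_le_left) ?_)) (hα.congr X n a n' a)
      exact inf_le_left.trans (inf_le_left.trans (hα.right X n a))
    · refine le_trans (le_inf (inf_le_left.trans inf_le_right)
        (le_inf ?_ (inf_le_right.trans inf_le_right))) (hβ.congr X a m a m')
      exact inf_le_left.trans (inf_le_left.trans (hα.right X n a))
  fun_ := hα.relComp_fun hβ
  inj X n m n' m' := by
    simp only [relComp_symm (α := α)]
    exact hβ.symm.relComp_fun hα.symm X m n m' n'
  surj X m := by
    simp only [relComp_symm (α := α)]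
    exact hβ.symm.relComp_total hα.symm X m
  total := hα.relComp_total hβ
  relMap := hα.relComp_map hβ
  relComap R x y := by
    simp only [relComp_symm (α := α)]
    exact hβ.symm.relComp_map hα.symm R y x

theorem Interp.IsIso.id_comp (hα : Interp.IsIso M N α) (hM : M.IsStr) :
    relComp M.sim α = α := by
  funext X n m
  refine le_antisymm (iSup_le fun a => ?_) (le_iSup_of_le n (le_inf (hα.left X n m) le_rfl))
  refine le_trans (le_inf inf_le_right (le_inf (inf_le_left.trans (hM.symm X n a))
    (inf_le_right.trans (hα.right X a m)))) (hα.congr X a m n m)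

theorem Interp.IsIso.comp_id (hα : Interp.IsIso M N α) :
    relComp α N.sim = α := by
  funext X n m
  refine le_antisymm (iSup_le fun a => ?_) (le_iSup_of_le m (le_inf le_rfl (hα.right X n m)))
  exact le_trans (le_inf inf_le_left (le_inf (inf_le_left.trans (hα.left X n a)) inf_le_right))
    (hα.congr X n a n m)

theorem Interp.IsIso.comp_symm (hα : Interp.IsIso M N α) (hM : M.IsStr) :
    relComp α (fun X n m => α X m n) = M.sim := by
  funext X n n'
  refine le_antisymm (iSup_le fun a => ?_) ?_
  · exact le_trans (le_inf le_rfl (inf_le_left.trans (hα.right X n a))) (hα.inj X n a n' a)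
  · refine (le_inf le_rfl ((hM.diag X n n').trans (hα.total X n))).trans ?_
    rw [inf_iSup_eq]
    refine iSup_mono fun m => le_inf inf_le_right ?_
    exact le_trans (le_inf inf_le_right (le_inf inf_le_left
      (inf_le_right.trans (hα.right X n m)))) (hα.congr X n m n' m)

theorem relComp_assoc (α β γ : L.Sorts → ℕ → ℕ → F) :
    relComp (relComp α β) γ = relComp α (relComp β γ) := by
  funext X n p
  simp only [relComp, iSup_inf_eq, inf_iSup_eq, inf_assoc]
  exact iSup_comm

theorem map_relComp {E : Type v'} [Frame E] (f : FrameHom E F) (α β : L.Sorts → ℕ → ℕ → E) :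
    (fun X n m => f (relComp α β X n m)) =
      relComp (fun X n m => f (α X n m)) (fun X n m => f (β X n m)) :=
  funext fun _ => funext fun _ => funext fun _ =>
    (map_iSup f _).trans (iSup_congr fun _ => map_inf f _ _)

end isos

section groupoid

variable (T : GeomTheory.{u, w})

/-- The assignment for an isomorphism `α` from `M` to `N`. -/
def Interp.iso {L : Signature.{u}} {F : Type v} (M N : Interp L F)
    (α : L.Sorts → ℕ → ℕ → F) : Interp (L.chain 1) F :=
  Interp.chain ![M, N] ![α]

theorem Interp.copy_iso_zero {L : Signature.{u}} {F : Type v} (M N : Interp L F)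
    (α : L.Sorts → ℕ → ℕ → F) : Interp.copy (0 : Fin 2) (Interp.iso M N α) = M := rfl

theorem Interp.copy_iso_one {L : Signature.{u}} {F : Type v} (M N : Interp L F)
    (α : L.Sorts → ℕ → ℕ → F) : Interp.copy (1 : Fin 2) (Interp.iso M N α) = N := rfl

theorem Interp.graph_iso {L : Signature.{u}} {F : Type v} (M N : Interp L F)
    (α : L.Sorts → ℕ → ℕ → F) : Interp.graph (0 : Fin 1) (Interp.iso M N α) = α := rfl

variable {T}

theorem Interp.IsIso.isModel {F : Type v} [Frame F] {M N : Interp T.sig F}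
    {α : T.sig.Sorts → ℕ → ℕ → F} (hα : Interp.IsIso M N α) (hM : M.IsModel T)
    (hN : N.IsModel T) : Interp.IsModel (T.chain 1) (Interp.iso M N α) :=
  .mk_chain (Fin.forall_fin_two.2 ⟨hM, hN⟩) (Fin.forall_fin_one.2 hα)

variable (T)

/-- The generic chain of `k` isomorphisms of models. -/
def GeomTheory.genericChain (k : ℕ) : Interp (T.sig.chain k) (T.chain k).P.frame :=
  (T.chain k).generic

theorem GeomTheory.genericChain_isModel (k : ℕ) :
    Interp.IsModel (T.chain k) (T.genericChain k) :=
  (T.chain k).generic_isModel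

/-- The locale of objects. -/
abbrev GeomTheory.G₀ : Locale.{u} := T.P.locale

/-- The locale of arrows. -/
abbrev GeomTheory.G₁ : Locale.{u} := (T.chain 1).P.locale

/-- The locale of composable pairs of arrows. -/
abbrev GeomTheory.G₂ : Locale.{u} := (T.chain 2).P.locale

variable {T}

/-- The morphism to the classifying locale of `P[T]` that is given by a model in a frame of opens. -/
def Interp.IsModel.toLocale {X : Locale.{u}} {M : Interp T.sig X} (h : M.IsModel T) :
    X ⟶ T.P.locale :=
  Quiver.Hom.op (Frm.ofHom h.hom)

/-- The model in the frame of opens of `X` that is given by a morphism from `X` to the classifying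
locale of `P[T]`. -/
def toModel {X : Locale.{u}} (f : X ⟶ T.P.locale) : Interp T.sig X :=
  T.generic.map f.unop.hom

theorem toModel_isModel {X : Locale.{u}} (f : X ⟶ T.P.locale) : (toModel f).IsModel T :=
  T.generic_isModel.map _

theorem Interp.IsModel.toModel_toLocale {X : Locale.{u}} {M : Interp T.sig X}
    (h : M.IsModel T) : toModel h.toLocale = M :=
  h.map_hom

theorem toModel_ext {X : Locale.{u}} {f g : X ⟶ T.P.locale} (h : toModel f = toModel g) :
    f = g :=
  Quiver.Hom.unop_inj (Frm.hom_ext (Interp.hom_ext h))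

theorem toModel_comp {X Y : Locale.{u}} (f : X ⟶ Y) (g : Y ⟶ T.P.locale) :
    toModel (f ≫ g) = (toModel g).map f.unop.hom := rfl

variable (T)

/-- The projection to the `c`-th model of a chain. -/
def GeomTheory.proj {k : ℕ} (c : Fin (k + 1)) : (T.chain k).P.locale ⟶ T.P.locale :=
  ((T.genericChain_isModel k).copy c).toLocale

/-- The projection to the `i`-th isomorphism of a chain. -/
def GeomTheory.edge {k : ℕ} (i : Fin k) : (T.chain k).P.locale ⟶ (T.chain 1).P.locale :=
  (((T.genericChain_isModel k).isIso i).isModel ((T.genericChain_isModel k).copy i.castSucc)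
    ((T.genericChain_isModel k).copy i.succ)).toLocale

/-- The identity map. The inverse image sends `R₀` and `R₁` to `R`, and `α` to `∼`. -/
def GeomTheory.ident : T.P.locale ⟶ (T.chain 1).P.locale :=
  ((Interp.IsIso.refl T.generic_isModel.isStr).isModel T.generic_isModel
    T.generic_isModel).toLocale

/-- The inversion map. The inverse image exchanges `R₀` and `R₁`, and sends `[α(n) = m]` to
`[α(m) = n]`. -/
def GeomTheory.inv : (T.chain 1).P.locale ⟶ (T.chain 1).P.locale :=
  (((T.genericChain_isModel 1).isIso 0).symm.isModel ((T.genericChain_isModel 1).copy 1)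
    ((T.genericChain_isModel 1).copy 0)).toLocale

/-- The composition map. The inverse image sends `R₀` to `R₀`, `R₁` to `R₂`, and `[α(n) = p]` to
the join of the meets `[α₀(n) = m] ⊓ [α₁(m) = p]` over all `m : ℕ`. -/
def GeomTheory.mul : (T.chain 2).P.locale ⟶ (T.chain 1).P.locale :=
  ((((T.genericChain_isModel 2).isIso 0).comp ((T.genericChain_isModel 2).isIso 1)).isModel
    ((T.genericChain_isModel 2).copy 0) ((T.genericChain_isModel 2).copy 2)).toLocale

variable {T}

theorem toModel_projDef {k : ℕ} (c : Fin (k + 1)) :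
    toModel (T.proj c) = Interp.copy (L := T.sig) c (T.genericChain k) :=
  Interp.IsModel.toModel_toLocale (X := (T.chain k).P.locale) _

theorem toModel_edge {k : ℕ} (i : Fin k) : toModel (T.edge i) =
    Interp.iso (L := T.sig) ((T.genericChain k).copy i.castSucc) ((T.genericChain k).copy i.succ)
      ((T.genericChain k).graph i) :=
  Interp.IsModel.toModel_toLocale (X := (T.chain k).P.locale) _

theorem toModel_ident : toModel T.ident = Interp.iso T.generic T.generic T.generic.sim :=
  Interp.IsModel.toModel_toLocale (X := T.P.locale) _

theorem toModel_inv : toModel T.inv =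
    Interp.iso (L := T.sig) ((T.genericChain 1).copy 1) ((T.genericChain 1).copy 0)
      (fun X n m => (T.genericChain 1).graph 0 X m n) :=
  Interp.IsModel.toModel_toLocale (X := (T.chain 1).P.locale) _

theorem toModel_mul : toModel T.mul =
    Interp.iso (L := T.sig) ((T.genericChain 2).copy 0) ((T.genericChain 2).copy 2)
      (relComp ((T.genericChain 2).graph 0) ((T.genericChain 2).graph 1)) :=
  Interp.IsModel.toModel_toLocale (X := (T.chain 2).P.locale) _

theorem toModel_proj {X : Locale.{u}} {k : ℕ} (f : X ⟶ (T.chain k).P.locale) (c : Fin (k + 1)) :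
    toModel (f ≫ T.proj c) = Interp.copy (L := T.sig) c (toModel f) :=
  congrArg (Interp.map f.unop.hom) (toModel_projDef c)

/-- The `i`-th isomorphism of the chain given by a morphism. -/
def graphOf {X : Locale.{u}} {k : ℕ} (f : X ⟶ (T.chain k).P.locale) (i : Fin k) :
    T.sig.Sorts → ℕ → ℕ → X :=
  Interp.graph (L := T.sig) i (toModel f)

theorem chain_ext {X : Locale.{u}} {k : ℕ} {f g : X ⟶ (T.chain k).P.locale}
    (h : ∀ c, f ≫ T.proj c = g ≫ T.proj c) (h' : ∀ i, graphOf f i = graphOf g i) : f = g := by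
  apply toModel_ext
  rw [← Interp.chain_eta (L := T.sig) (toModel f), ← Interp.chain_eta (L := T.sig) (toModel g)]
  congr 1
  · funext c
    rw [← toModel_proj, ← toModel_proj, h]
  · exact funext h'

theorem graphOf_isIso {X : Locale.{u}} {k : ℕ} (f : X ⟶ (T.chain k).P.locale) (i : Fin k) :
    Interp.IsIso (toModel (f ≫ T.proj i.castSucc)) (toModel (f ≫ T.proj i.succ))
      (graphOf f i) := by
  rw [toModel_proj, toModel_proj]
  exact (toModel_isModel f).isIso i

theorem graphOf_comp {X : Locale.{u}} {j k : ℕ} (f : X ⟶ (T.chain k).P.locale)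
    (g : (T.chain k).P.locale ⟶ (T.chain j).P.locale) (i : Fin j) :
    graphOf (f ≫ g) i = fun Y n m => f.unop.hom (graphOf g i Y n m) := rfl

theorem edge_proj_zero {k : ℕ} (i : Fin k) : T.edge i ≫ T.proj 0 = T.proj i.castSucc :=
  toModel_ext ((toModel_proj _ _).trans
    (((congrArg (Interp.copy 0) (toModel_edge i)).trans (Interp.copy_iso_zero _ _ _)).trans
      (toModel_projDef _).symm))

theorem edge_proj_one {k : ℕ} (i : Fin k) : T.edge i ≫ T.proj 1 = T.proj i.succ :=
  toModel_ext ((toModel_proj _ _).trans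
    (((congrArg (Interp.copy 1) (toModel_edge i)).trans (Interp.copy_iso_one _ _ _)).trans
      (toModel_projDef _).symm))

theorem graphOf_edge {X : Locale.{u}} {k : ℕ} (f : X ⟶ (T.chain k).P.locale) (i : Fin k) :
    graphOf (f ≫ T.edge i) 0 = graphOf f i :=
  (graphOf_comp f (T.edge i) 0).trans
    (congrArg (fun α Y n m => f.unop.hom (α Y n m))
      ((congrArg (Interp.graph 0) (toModel_edge i)).trans (Interp.graph_iso _ _ _)))

theorem ident_proj (c : Fin 2) : T.ident ≫ T.proj c = 𝟙 _ :=
  toModel_ext ((toModel_proj _ _).trans ((congrArg (Interp.copy c) toModel_ident).trans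
    ((Fin.forall_fin_two (p := fun c => Interp.copy c
      (Interp.iso T.generic T.generic T.generic.sim) = T.generic)).2 ⟨rfl, rfl⟩ c)))

theorem graphOf_ident {X : Locale.{u}} (f : X ⟶ T.P.locale) :
    graphOf (f ≫ T.ident) 0 = (toModel f).sim :=
  congrArg (fun M => Interp.graph 0 (Interp.map f.unop.hom M)) toModel_ident

theorem inv_proj_zero : T.inv ≫ T.proj 0 = T.proj 1 :=
  toModel_ext ((toModel_proj _ _).trans
    (((congrArg (Interp.copy 0) toModel_inv).trans (Interp.copy_iso_zero _ _ _)).trans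
      (toModel_projDef _).symm))

theorem inv_proj_one : T.inv ≫ T.proj 1 = T.proj 0 :=
  toModel_ext ((toModel_proj _ _).trans
    (((congrArg (Interp.copy 1) toModel_inv).trans (Interp.copy_iso_one _ _ _)).trans
      (toModel_projDef _).symm))

theorem graphOf_inv {X : Locale.{u}} (f : X ⟶ (T.chain 1).P.locale) :
    graphOf (f ≫ T.inv) 0 = fun Y n m => graphOf f 0 Y m n :=
  (graphOf_comp f T.inv 0).trans
    (congrArg (fun α Y n m => f.unop.hom (α Y n m))
      ((congrArg (Interp.graph 0) toModel_inv).trans (Interp.graph_iso _ _ _)))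

theorem mul_proj_zero : T.mul ≫ T.proj 0 = T.proj 0 :=
  toModel_ext ((toModel_proj _ _).trans
    (((congrArg (Interp.copy 0) toModel_mul).trans (Interp.copy_iso_zero _ _ _)).trans
      (toModel_projDef _).symm))

theorem mul_proj_one : T.mul ≫ T.proj 1 = T.proj 2 :=
  toModel_ext ((toModel_proj _ _).trans
    (((congrArg (Interp.copy 1) toModel_mul).trans (Interp.copy_iso_one _ _ _)).trans
      (toModel_projDef _).symm))

theorem graphOf_mul {X : Locale.{u}} (f : X ⟶ (T.chain 2).P.locale) :
    graphOf (f ≫ T.mul) 0 = relComp (graphOf f 0) (graphOf f 1) :=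
  ((graphOf_comp f T.mul 0).trans
    (congrArg (fun α Y n m => f.unop.hom (α Y n m))
      ((congrArg (Interp.graph 0) toModel_mul).trans (Interp.graph_iso _ _ _)))).trans
    (map_relComp f.unop.hom _ _)

theorem edge_zero_proj_one : T.edge (k := 2) 0 ≫ T.proj 1 = T.edge 1 ≫ T.proj 0 := by
  rw [edge_proj_one, edge_proj_zero]
  rfl

/-- The morphism to the locale of composable pairs given by two composable arrows. -/
theorem exists_pair {X : Locale.{u}} (f g : X ⟶ (T.chain 1).P.locale)
    (h : f ≫ T.proj 1 = g ≫ T.proj 0) :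
    ∃ p : X ⟶ (T.chain 2).P.locale, p ≫ T.edge 0 = f ∧ p ≫ T.edge 1 = g := by
  have hN : Interp.IsModel (T.chain 2)
      (Interp.chain ![toModel (f ≫ T.proj 0), toModel (f ≫ T.proj 1), toModel (g ≫ T.proj 1)]
        ![graphOf f 0, graphOf g 0]) := by
    refine .mk_chain (fun c => ?_) (Fin.forall_fin_two.2 ⟨graphOf_isIso f 0, ?_⟩)
    · fin_cases c <;> exact toModel_isModel _
    · have := graphOf_isIso g 0
      change Interp.IsIso (toModel (g ≫ T.proj 0)) _ _ at this
      rw [← h] at this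
      exact this
  refine ⟨hN.toLocale, ?_, ?_⟩
  · refine chain_ext (Fin.forall_fin_two.2 ⟨?_, ?_⟩) (Fin.forall_fin_one.2 ?_)
    · rw [Category.assoc, edge_proj_zero]
      apply toModel_ext
      rw [toModel_proj, hN.toModel_toLocale]
      rfl
    · rw [Category.assoc, edge_proj_one]
      apply toModel_ext
      rw [toModel_proj, hN.toModel_toLocale]
      rfl
    · rw [graphOf_edge, graphOf, hN.toModel_toLocale]
      rfl
  · refine chain_ext (Fin.forall_fin_two.2 ⟨?_, ?_⟩) (Fin.forall_fin_one.2 ?_)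
    · rw [Category.assoc, edge_proj_zero, ← h]
      apply toModel_ext
      rw [toModel_proj, hN.toModel_toLocale]
      rfl
    · rw [Category.assoc, edge_proj_one]
      apply toModel_ext
      rw [toModel_proj, hN.toModel_toLocale]
      rfl
    · rw [graphOf_edge, graphOf, hN.toModel_toLocale]
      rfl

theorem pair_ext {X : Locale.{u}} {p q : X ⟶ (T.chain 2).P.locale}
    (h₀ : p ≫ T.edge 0 = q ≫ T.edge 0) (h₁ : p ≫ T.edge 1 = q ≫ T.edge 1) : p = q := by
  have e0 : T.edge 0 ≫ T.proj 0 = T.proj (k := 2) 0 := edge_proj_zero 0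
  have e1 : T.edge 0 ≫ T.proj 1 = T.proj (k := 2) 1 := edge_proj_one 0
  have e2 : T.edge 1 ≫ T.proj 1 = T.proj (k := 2) 2 := edge_proj_one 1
  refine chain_ext (fun c => ?_) (Fin.forall_fin_two.2 ⟨?_, ?_⟩)
  · fin_cases c
    · change p ≫ T.proj 0 = q ≫ T.proj 0
      rw [← e0, ← Category.assoc, h₀, Category.assoc]
    · change p ≫ T.proj 1 = q ≫ T.proj 1
      rw [← e1, ← Category.assoc, h₀, Category.assoc]
    · change p ≫ T.proj 2 = q ≫ T.proj 2
      rw [← e2, ← Category.assoc, h₁, Category.assoc]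
  · rw [← graphOf_edge, h₀, graphOf_edge]
  · rw [← graphOf_edge, h₁, graphOf_edge]

variable (T)

theorem isPullback_edge :
    IsPullback (T.edge (k := 2) 0) (T.edge 1) (T.proj (k := 1) 1) (T.proj 0) where
  w := edge_zero_proj_one
  isLimit' := ⟨Limits.PullbackCone.IsLimit.mk _
    (fun c => (exists_pair c.fst c.snd c.condition).choose)
    (fun c => (exists_pair c.fst c.snd c.condition).choose_spec.1)
    (fun c => (exists_pair c.fst c.snd c.condition).choose_spec.2)
    (fun c _ h₀ h₁ => pair_ext
      (h₀.trans (exists_pair c.fst c.snd c.condition).choose_spec.1.symm)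
      (h₁.trans (exists_pair c.fst c.snd c.condition).choose_spec.2.symm))⟩

variable {T}

/-- Two arrows are equal if they have the same source, the same target and the same graph. -/
theorem arrow_ext {X : Locale.{u}} {f g : X ⟶ (T.chain 1).P.locale}
    (h₀ : f ≫ T.proj 0 = g ≫ T.proj 0) (h₁ : f ≫ T.proj 1 = g ≫ T.proj 1)
    (h : graphOf f 0 = graphOf g 0) : f = g :=
  chain_ext (Fin.forall_fin_two.2 ⟨h₀, h₁⟩) (Fin.forall_fin_one.2 h)

section lift

variable {X : Locale.{u}} (f g : X ⟶ (T.chain 1).P.locale) (h : f ≫ T.proj 1 = g ≫ T.proj 0)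

theorem graphOf_lift_mul : graphOf ((isPullback_edge T).lift f g h ≫ T.mul) 0
    = relComp (graphOf f 0) (graphOf g 0) := by
  have h₀ := (graphOf_edge ((isPullback_edge T).lift f g h) 0).symm
  have h₁ := (graphOf_edge ((isPullback_edge T).lift f g h) 1).symm
  rw [(isPullback_edge T).lift_fst] at h₀
  rw [(isPullback_edge T).lift_snd] at h₁
  rw [graphOf_mul, h₀, h₁]

theorem lift_mul_proj_zero :
    ((isPullback_edge T).lift f g h ≫ T.mul) ≫ T.proj 0 = f ≫ T.proj 0 := by
  have e0 : T.edge 0 ≫ T.proj 0 = T.proj (k := 2) 0 := edge_proj_zero 0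
  rw [Category.assoc, mul_proj_zero, ← e0, ← Category.assoc, (isPullback_edge T).lift_fst]

theorem lift_mul_proj_one :
    ((isPullback_edge T).lift f g h ≫ T.mul) ≫ T.proj 1 = g ≫ T.proj 1 := by
  have e2 : T.edge 1 ≫ T.proj 1 = T.proj (k := 2) 2 := edge_proj_one 1
  rw [Category.assoc, mul_proj_one, ← e2, ← Category.assoc, (isPullback_edge T).lift_snd]

theorem graphOf_isIso' : Interp.IsIso (toModel (f ≫ T.proj 0)) (toModel (f ≫ T.proj 1))
    (graphOf f 0) :=
  graphOf_isIso f 0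

end lift

variable (T)

/-- The localic groupoid of a geometric theory. -/
def GeomTheory.groupoid : LocalicGroupoid.{u} where
  G₀ := T.G₀
  G₁ := T.G₁
  G₂ := T.G₂
  s := T.proj 0
  t := T.proj 1
  e := T.ident
  i := T.inv
  p₁ := T.edge 0
  p₂ := T.edge 1
  m := T.mul
  isPullback := isPullback_edge T
  e_s := ident_proj 0
  e_t := ident_proj 1
  m_s := mul_proj_zero.trans (edge_proj_zero (T := T) (k := 2) 0).symm
  m_t := mul_proj_one.trans (edge_proj_one (T := T) (k := 2) 1).symm
  i_s := inv_proj_zero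
  i_t := inv_proj_one
  i_i := arrow_ext
    (by rw [Category.assoc, inv_proj_zero, inv_proj_one, Category.id_comp])
    (by rw [Category.assoc, inv_proj_one, inv_proj_zero, Category.id_comp])
    (by rw [graphOf_inv, ← Category.id_comp T.inv, graphOf_inv])
  id_comp := by
    refine arrow_ext ?_ ?_ ?_
    · rw [lift_mul_proj_zero, Category.assoc, ident_proj, Category.comp_id, Category.id_comp]
    · rw [lift_mul_proj_one]
    · rw [graphOf_lift_mul, graphOf_ident, ← Category.id_comp (T.proj 0)]
      exact (graphOf_isIso' _).id_comp (toModel_isModel _).isStr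
  comp_id := by
    refine arrow_ext ?_ ?_ ?_
    · rw [lift_mul_proj_zero]
    · rw [lift_mul_proj_one, Category.assoc, ident_proj, Category.comp_id, Category.id_comp]
    · rw [graphOf_lift_mul, graphOf_ident, ← Category.id_comp (T.proj 1)]
      exact (graphOf_isIso' _).comp_id
  comp_inv := by
    refine arrow_ext ?_ ?_ ?_
    · rw [lift_mul_proj_zero, Category.assoc, ident_proj, Category.comp_id, Category.id_comp]
    · rw [lift_mul_proj_one, Category.assoc, ident_proj, Category.comp_id, inv_proj_one]
    · rw [graphOf_lift_mul, graphOf_ident, ← Category.id_comp T.inv, graphOf_inv,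
        ← Category.id_comp (T.proj 0)]
      exact (graphOf_isIso' _).comp_symm (toModel_isModel _).isStr
  inv_comp := by
    refine arrow_ext ?_ ?_ ?_
    · rw [lift_mul_proj_zero, Category.assoc, ident_proj, Category.comp_id, inv_proj_zero]
    · rw [lift_mul_proj_one, Category.assoc, ident_proj, Category.comp_id, Category.id_comp]
    · rw [graphOf_lift_mul, graphOf_ident, ← Category.id_comp T.inv, graphOf_inv,
        ← Category.id_comp (T.proj 1)]
      exact (graphOf_isIso' _).symm.comp_symm (toModel_isModel _).isStr
  assoc f g h hfg hgh := by
    refine arrow_ext ?_ ?_ ?_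
    · simp only [lift_mul_proj_zero]
    · simp only [lift_mul_proj_one]
    · simp only [graphOf_lift_mul, relComp_assoc]

end groupoid

end Geom

namespace Geom

open CategoryTheory Order

/-! ### Countable theories have countable presentations -/

/-! The argument has a logical half and a formal half.

Logical half: a frame with countably many relations has enough points. An element of the presented
frame is a lower set of finite sets of generators that is closed under the nucleus, and a point is a
set `S` of generators that satisfies every relation. Suppose `U ≤ V` fails, as witnessed by a finite
set `A` in `U` but not in `V`. In the manner of the Rasiowa–Sikorski lemma, `A` is enlarged through
a sequence of finite sets, none of them in `V`. Whenever the left hand side of the relation under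
consideration has become true, some member of its right hand side is added, and
`Presentation.exists_union_notMem` says that this can be done without entering `V`. As the relations
are countable, one sequence can return to each of them infinitely often. The union of the sequence
is then a model in which `U` holds and `V` fails (`Presentation.exists_model`,
`Presentation.le_of_forall_point`). Enough points make the counit of the adjunction between spaces
and locales invertible (`isIso_counit_of_forall_point`). This applies to all three locales, because
the theories of chains of isomorphisms of models are again countable
(`GeomTheory.IsCountable.chain`).

Formal half: the functor of points is right adjoint to the functor of open sets, so it preserves
pullbacks and turns a localic groupoid into a topological one (`InternalGroupoid.mapRightAdjoint`).
The counit compares the open sets of this topological groupoid with the original localic one, and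
its naturality gives all compatibility squares (`LocalicGroupoid.arisesFrom_points`). The functor of
open sets need not preserve pullbacks, so spatiality of the locale of composable pairs is a separate
requirement. It holds because that locale too classifies a countable theory. -/

theorem countable_basicProp {L : Signature.{u}} [Countable L.Sorts] [Countable L.Rels] :
    Countable (BasicProp L) := by
  let f : BasicProp L → (L.Sorts × ℕ × ℕ) ⊕ (Σ R : L.Rels, Fin (L.arity R) → ℕ)
    | .sim X n m => .inl (X, n, m)
    | .mem R n => .inr ⟨R, n⟩
  refine Function.Injective.countable (f := f) ?_
  rintro (⟨X, n, m⟩ | ⟨R, n⟩) (⟨X', n', m'⟩ | ⟨R', n'⟩) h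
  · cases h; rfl
  · cases h
  · cases h
  · cases h; rfl

theorem GeomTheory.IsCountable.countable_gen {T : GeomTheory.{u, w}} (hT : T.IsCountable) :
    Countable T.P.Gen :=
  have := hT.sorts
  have := hT.rels
  countable_basicProp

/-- The index sets of disjunctions play no role here: a disjunction is evaluated to a single element
of the free frame. Hence each axiom contributes only one relation for each finite tuple of natural
numbers, and each of the five kinds of relation is the range of a map from a countable type. -/
theorem GeomTheory.IsCountable.countable_rel {T : GeomTheory.{u, w}} (hT : T.IsCountable) :
    T.P.rel.Countable := by
  have := hT.sorts
  have := hT.rels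
  have := hT.axioms.to_subtype
  let M := Interp.free T.sig
  let fsymm : T.sig.Sorts × ℕ × ℕ → FreeFrame T.P.Gen × FreeFrame T.P.Gen := fun p =>
    (M.sim p.1 p.2.1 p.2.2, M.sim p.1 p.2.2 p.2.1)
  let ftrans : T.sig.Sorts × ℕ × ℕ × ℕ → FreeFrame T.P.Gen × FreeFrame T.P.Gen := fun p =>
    (M.sim p.1 p.2.1 p.2.2.1 ⊓ M.sim p.1 p.2.2.1 p.2.2.2, M.sim p.1 p.2.1 p.2.2.2)
  let fcongr : (Σ R : T.sig.Rels, (Fin (T.sig.arity R) → ℕ) × (Fin (T.sig.arity R) → ℕ)) →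
      FreeFrame T.P.Gen × FreeFrame T.P.Gen := fun p =>
    (M.mem p.1 p.2.1 ⊓ ⨅ j, M.sim (T.sig.dom p.1 j) (p.2.1 j) (p.2.2 j), M.mem p.1 p.2.2)
  let fstrict : (Σ R : T.sig.Rels, Fin (T.sig.arity R) → ℕ) →
      FreeFrame T.P.Gen × FreeFrame T.P.Gen := fun p =>
    (M.mem p.1 p.2, ⨅ j, M.sim (T.sig.dom p.1 j) (p.2 j) (p.2 j))
  let fax : (Σ σ : T.axioms, Fin σ.1.len → ℕ) → FreeFrame T.P.Gen × FreeFrame T.P.Gen :=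
    fun p => ((⨅ i, M.sim (p.1.1.ctx i) (p.2 i) (p.2 i)) ⊓ p.1.1.lhs.val M p.2,
      p.1.1.rhs.val M p.2)
  refine ((((Set.countable_range fsymm).union (Set.countable_range ftrans)).union
    (Set.countable_range fcongr)).union ((Set.countable_range fstrict).union
      (Set.countable_range fax))).mono ?_
  rintro ⟨a, b⟩ (h : T.PropAxiom M a b)
  cases h with
  | symm X n m => exact .inl (.inl (.inl ⟨(X, n, m), rfl⟩))
  | trans X n m l => exact .inl (.inl (.inr ⟨(X, n, m, l), rfl⟩))
  | congr R n m => exact .inl (.inr ⟨⟨R, n, m⟩, rfl⟩)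
  | strict R n => exact .inr (.inl ⟨⟨R, n⟩, rfl⟩)
  | ax σ hσ ν => exact .inr (.inr ⟨⟨⟨σ, hσ⟩, ν⟩, rfl⟩)

/-- This reduces the locales of arrows and of composable pairs to the case of a classifying locale
of a countable theory: only finitely many copies are made, and the additional axioms are indexed by
the links of the chain together with sorts or relation symbols. -/
theorem GeomTheory.IsCountable.chain {T : GeomTheory.{u, w}} (hT : T.IsCountable) (k : ℕ) :
    (T.chain k).IsCountable := by
  have := hT.sorts
  have := hT.rels
  have := hT.axioms.to_subtype
  refine ⟨inferInstanceAs (Countable (Fin (k + 1) × T.sig.Sorts)),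
    inferInstanceAs (Countable ((Fin (k + 1) × T.sig.Rels) ⊕ (Fin k × T.sig.Sorts))), ?_⟩
  let fcopy : Fin (k + 1) × T.axioms → Sequent.{u, w} (T.sig.chain k) := fun p => p.2.1.copy p.1
  let ffun : Fin k × T.sig.Sorts → Sequent.{u, w} (T.sig.chain k) := fun p =>
    ⟨4, _, pairEqLeft p.1 p.2, pairEqRight p.1 p.2⟩
  let finj : Fin k × T.sig.Sorts → Sequent.{u, w} (T.sig.chain k) := fun p =>
    ⟨4, _, pairEqRight p.1 p.2, pairEqLeft p.1 p.2⟩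
  let fsurj : Fin k × T.sig.Sorts → Sequent.{u, w} (T.sig.chain k) := fun p => surjSeq p.1 p.2
  let ftotal : Fin k × T.sig.Sorts → Sequent.{u, w} (T.sig.chain k) := fun p => totalSeq p.1 p.2
  let fmap : Fin k × T.sig.Rels → Sequent.{u, w} (T.sig.chain k) := fun p =>
    ⟨_, _, relLeft p.1 p.2, relRight p.1 p.2⟩
  let fcomap : Fin k × T.sig.Rels → Sequent.{u, w} (T.sig.chain k) := fun p =>
    ⟨_, _, relRight p.1 p.2, relLeft p.1 p.2⟩
  refine ((Set.countable_range fcopy).union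
    (((Set.countable_range ffun).union (Set.countable_range finj)).union
      (((Set.countable_range fsurj).union (Set.countable_range ftotal)).union
        ((Set.countable_range fmap).union (Set.countable_range fcomap))))).mono ?_
  intro σ (h : T.ChainAxiom k σ)
  cases h with
  | copy c σ hσ => exact .inl ⟨(c, ⟨σ, hσ⟩), rfl⟩
  | fun_ i X => exact .inr (.inl (.inl ⟨(i, X), rfl⟩))
  | inj i X => exact .inr (.inl (.inr ⟨(i, X), rfl⟩))
  | surj i X => exact .inr (.inr (.inl (.inl ⟨(i, X), rfl⟩)))
  | total i X => exact .inr (.inr (.inl (.inr ⟨(i, X), rfl⟩)))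
  | relMap i R => exact .inr (.inr (.inr (.inl ⟨(i, R), rfl⟩)))
  | relComap i R => exact .inr (.inr (.inr (.inr ⟨(i, R), rfl⟩)))

theorem GeomTheory.IsCountable.isCountablyPresented {T : GeomTheory.{u, w}}
    (hT : T.IsCountable) : IsCountablyPresented T.P.locale :=
  ⟨T.P, hT.countable_gen, hT.countable_rel, ⟨Iso.refl _⟩⟩

/-! ### Countably presented frames have enough points -/

/-- An element of the free frame is a join of finite meets of generators, so its truth under the
valuation given by `S` has a finite witness. This finiteness is what allows truth in the union of an
increasing sequence to be detected at a finite stage. -/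
theorem FreeFrame.lift_mem_iff {G : Type u} (S : Set G) (U : FreeFrame G) :
    FreeFrame.lift (· ∈ S) U ↔ ∃ A : Finset G, OrderDual.toDual A ∈ U ∧ (A : Set G) ⊆ S := by
  change (⨆ a ∈ U, (OrderDual.ofDual a).inf (· ∈ S)) ↔ _
  have inf_iff (A : Finset G) : A.inf (· ∈ S) ↔ (A : Set G) ⊆ S := by
    rw [Finset.inf_eq_iInf]
    simp only [iInf_Prop_eq]
    rfl
  simp only [iSup_Prop_eq, exists_prop, inf_iff]
  rfl

namespace Presentation

variable (P : Presentation.{u})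

/-- If a closed lower set `V` omits `A`, and the left hand side of a relation contains `A`, then
some member of the right hand side can be added to `A` in such a way that `V` omits the union. -/
theorem exists_union_notMem [DecidableEq P.Gen] {V : FreeFrame P.Gen} (hV : P.nucleus V = V)
    {r : FreeFrame P.Gen × FreeFrame P.Gen} (hr : r ∈ P.rel) {A : Finset P.Gen}
    (hA : OrderDual.toDual A ∈ r.1) (hAV : OrderDual.toDual A ∉ V) :
    ∃ B, OrderDual.toDual B ∈ r.2 ∧ OrderDual.toDual (A ∪ B) ∉ V := by
  by_contra! h
  -- The members of this meet are the members of `r.2` that contain `A`. For such a `B` the union `A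
  -- ∪ B` is `B` itself, so the negated claim puts `B` into `V`.
  have hle : r.2 ⊓ LowerSet.Iic (OrderDual.toDual A) ≤ V := by
    rintro B ⟨hB, hAB⟩
    have h' := h (OrderDual.ofDual B) hB
    rwa [Finset.union_eq_right.2 (show A ⊆ OrderDual.ofDual B from hAB)] at h'
  -- The nucleus preserves binary meets, so the relation `r` can be localised below `A`.
  -- Monotonicity and closedness of `V` then force `A` into `V`.
  have hmem : OrderDual.toDual A ∈ P.nucleus (r.2 ⊓ LowerSet.Iic (OrderDual.toDual A)) := by
    rw [map_inf]
    exact ⟨P.le_nucleus hr hA, P.nucleus.le_apply (LowerSet.mem_Iic_iff.2 le_rfl)⟩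
  have := P.nucleus.monotone hle hmem
  rw [hV] at this
  exact hAV this

/-- If there are countably many relations, then every finite set of generators that a closed lower
set `V` omits is contained in a model of the relations that does not satisfy `V`. -/
theorem exists_model (hP : P.rel.Countable) {V : FreeFrame P.Gen} (hV : P.nucleus V = V)
    {A : Finset P.Gen} (hA : OrderDual.toDual A ∉ V) :
    ∃ S : Set P.Gen, (A : Set P.Gen) ⊆ S ∧
      (∀ r ∈ P.rel, FreeFrame.lift (· ∈ S) r.1 ≤ FreeFrame.lift (· ∈ S) r.2) ∧
      ¬ FreeFrame.lift (· ∈ S) V := by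
  classical
  rcases P.rel.eq_empty_or_nonempty with hE | hE
  -- An empty set of relations cannot be enumerated by `ℕ`, but then `A` itself is already a model.
  · refine ⟨A, subset_rfl, by simp [hE], fun h => ?_⟩
    obtain ⟨B, hB, hBA⟩ := (FreeFrame.lift_mem_iff _ _).1 h
    exact hA (V.lower (OrderDual.toDual_le_toDual.2 (Finset.coe_subset.1 hBA)) hB)
  obtain ⟨f, hf⟩ := hP.exists_eq_range hE
  have hfr (n : ℕ) : f n ∈ P.rel := hf ▸ Set.mem_range_self n
  -- One stage of the construction: if the left hand side of the `n`-th relation holds at `C`, its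
  -- right hand side is made true at `D`; otherwise `C` is kept.
  have step (n : ℕ) (C : {C : Finset P.Gen // OrderDual.toDual C ∉ V}) :
      ∃ D : {D : Finset P.Gen // OrderDual.toDual D ∉ V}, C.1 ⊆ D.1 ∧
        (OrderDual.toDual C.1 ∈ (f n).1 → ∃ B ⊆ D.1, OrderDual.toDual B ∈ (f n).2) := by
    by_cases hC : OrderDual.toDual C.1 ∈ (f n).1
    · obtain ⟨B, hB, hCB⟩ := P.exists_union_notMem hV (hfr n) hC C.2
      exact ⟨⟨_, hCB⟩, Finset.subset_union_left, fun _ => ⟨B, Finset.subset_union_right, hB⟩⟩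
    · exact ⟨C, subset_rfl, fun h => absurd h hC⟩
  choose next hsub hnext using step
  -- Stage `n` treats the relation with index `n.unpair.1`, so every relation is treated at
  -- arbitrarily late stages. This is needed because the left hand side of a relation may become
  -- true only after the relation was first considered.
  let C : ℕ → {C : Finset P.Gen // OrderDual.toDual C ∉ V} := fun n =>
    Nat.rec ⟨A, hA⟩ (fun n C => next n.unpair.1 C) n
  have hC (n : ℕ) : C (n + 1) = next n.unpair.1 (C n) := rfl
  have mono : Monotone fun n => (C n).1 := monotone_nat_of_le_succ fun n => hsub _ _
  have bound (B : Finset P.Gen) (hB : (B : Set P.Gen) ⊆ ⋃ n, ((C n).1 : Set P.Gen)) :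
      ∃ n, B ⊆ (C n).1 := by
    have hdir : Directed (· ⊆ ·) fun n => ((C n).1 : Set P.Gen) :=
      (Monotone.directed_le fun i j hij => Finset.coe_subset.2 (mono hij) :)
    obtain ⟨n, hn⟩ := hdir.exists_mem_subset_of_finset_subset_biUnion hB
    exact ⟨n, Finset.coe_subset.1 hn⟩
  refine ⟨⋃ n, ((C n).1 : Set P.Gen), Set.subset_iUnion (fun n => ((C n).1 : Set P.Gen)) 0,
    fun r hr h => ?_, fun h => ?_⟩
  · obtain ⟨B, hB, hBS⟩ := (FreeFrame.lift_mem_iff _ _).1 h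
    obtain ⟨n, hn⟩ := bound B hBS
    obtain ⟨i, rfl⟩ : r ∈ Set.range f := hf ▸ hr
    -- The left hand side of the `i`-th relation is true from stage `n` on. Stage `Nat.pair i n`
    -- treats this relation and is not earlier than `n`.
    have hle : n ≤ Nat.pair i n := Nat.right_le_pair i n
    have hmem : OrderDual.toDual (C (Nat.pair i n)).1 ∈ (f i).1 :=
      (f i).1.lower (OrderDual.toDual_le_toDual.2 (hn.trans (mono hle))) hB
    have hstep := hnext i (C (Nat.pair i n)) hmem
    have hsucc := hC (Nat.pair i n)
    rw [Nat.unpair_pair] at hsucc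
    rw [← hsucc] at hstep
    obtain ⟨D, hD, hDr⟩ := hstep
    exact (FreeFrame.lift_mem_iff _ _).2 ⟨D, hDr, (Finset.coe_subset.2 hD).trans
      (Set.subset_iUnion (fun n => ((C n).1 : Set P.Gen)) (Nat.pair i n + 1))⟩
  -- If `V` held in the union, a finite witness would be contained in some stage, and that stage
  -- would lie in the lower set `V`.
  · obtain ⟨B, hB, hBS⟩ := (FreeFrame.lift_mem_iff _ _).1 h
    obtain ⟨n, hn⟩ := bound B hBS
    exact (C n).2 (V.lower (OrderDual.toDual_le_toDual.2 hn) hB)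

/-- A frame with countably many relations has enough points. -/
theorem le_of_forall_point (hP : P.rel.Countable) {U V : P.frame}
    (h : ∀ p : FrameHom P.frame Prop, p U → p V) : U ≤ V := by
  intro A hA
  by_contra hAV
  -- The elements of the presented frame are values of an idempotent map, hence fixed by it.
  have hV : P.nucleus V.1 = V.1 := by
    obtain ⟨W, hW⟩ := V.2
    rw [← hW, P.nucleus.idempotent]
  obtain ⟨S, hAS, hS, hSV⟩ := P.exists_model hP (A := OrderDual.ofDual A) hV hAV
  exact hSV (h (lift (· ∈ S) hS) ((FreeFrame.lift_mem_iff S U.1).2 ⟨_, hA, hAS⟩))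

end Presentation

/-! ### Enough points and the counit of the adjunction between spaces and locales -/

/-- The frame map underlying the counit sends `U` to the set of points at which `U` holds. It is
surjective because the open sets of the space of points are by definition the sets of this form, and
the hypothesis says exactly that it reflects the order. It is therefore an order isomorphism, and so
an isomorphism of frames. -/
theorem isIso_counit_of_forall_point {X : Locale.{u}}
    (h : ∀ U V : X, (∀ p : FrameHom X Prop, p U → p V) → U ≤ V) :
    IsIso (Locale.adjunctionTopToLocalePT.counit.app X) := by
  let e : X ≃o TopologicalSpace.Opens (Locale.PT X) :=
    { Equiv.ofBijective (Locale.counitAppCont X) (by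
        refine ⟨fun U V hUV => ?_, ?_⟩
        · have key (p : FrameHom X Prop) : p U ↔ p V :=
            Iff.of_eq (congrArg (fun W : TopologicalSpace.Opens (Locale.PT X) => p ∈ W) hUV)
          exact le_antisymm (h U V fun p => (key p).1) (h V U fun p => (key p).2)
        · rintro ⟨_, U, rfl⟩
          exact ⟨U, rfl⟩) with
      map_rel_iff' := ⟨fun hUV => h _ _ fun p hp => hUV hp,
        fun hUV => OrderHomClass.mono (Locale.counitAppCont X) hUV⟩ }
  have : IsIso (Frm.ofHom (Locale.counitAppCont X)) :=
    (Frm.Iso.mk (α := X.unop) (β := Frm.of (TopologicalSpace.Opens (Locale.PT X))) e).isIso_hom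
  exact inferInstanceAs (IsIso (Frm.ofHom (Locale.counitAppCont X)).op)

theorem Presentation.isIso_counit (P : Presentation.{u}) (hP : P.rel.Countable) :
    IsIso (Locale.adjunctionTopToLocalePT.counit.app P.locale) :=
  isIso_counit_of_forall_point fun _ _ => P.le_of_forall_point hP

/-! ### The image of a groupoid under a right adjoint -/

section rightAdjoint

variable {C : Type*} [Category* C] {D : Type*} [Category* D] {L : D ⥤ C} {R : C ⥤ D}

/-- Transposition along the adjunction turns a pairing into the pairing of the transposes. This
serves the associativity law, whose arrows start at an arbitrary object of `D` and need not be
images under `R`. -/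
theorem homEquiv_symm_lift (adj : L ⊣ R) {A B₁ B₂ Z : C} {p₁ : A ⟶ B₁} {p₂ : A ⟶ B₂}
    {t : B₁ ⟶ Z} {s : B₂ ⟶ Z} (hp : IsPullback p₁ p₂ t s)
    (hR : IsPullback (R.map p₁) (R.map p₂) (R.map t) (R.map s)) {U : D} (f : U ⟶ R.obj B₁)
    (g : U ⟶ R.obj B₂) (h : f ≫ R.map t = g ≫ R.map s) :
    (adj.homEquiv _ _).symm (hR.lift f g h) =
      hp.lift ((adj.homEquiv _ _).symm f) ((adj.homEquiv _ _).symm g) (by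
        rw [← adj.homEquiv_naturality_right_symm, h, adj.homEquiv_naturality_right_symm]) := by
  apply hp.hom_ext
  · rw [hp.lift_fst, ← adj.homEquiv_naturality_right_symm, hR.lift_fst]
  · rw [hp.lift_snd, ← adj.homEquiv_naturality_right_symm, hR.lift_snd]

/-- The components `f'` and `g'` are tied to `R.map f` and `R.map g` by equations, so that the lemma
also rewrites lifts whose components are identities or composites. Rewriting these inside the lift
would affect its proof argument. -/
theorem map_lift {A B₁ B₂ Z : C} {p₁ : A ⟶ B₁} {p₂ : A ⟶ B₂}
    {t : B₁ ⟶ Z} {s : B₂ ⟶ Z} (hp : IsPullback p₁ p₂ t s)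
    (hR : IsPullback (R.map p₁) (R.map p₂) (R.map t) (R.map s)) {U : C} {f : U ⟶ B₁}
    {g : U ⟶ B₂} (h : f ≫ t = g ≫ s) {f' : R.obj U ⟶ R.obj B₁} {g' : R.obj U ⟶ R.obj B₂}
    (hf : f' = R.map f) (hg : g' = R.map g) (h' : f' ≫ R.map t = g' ≫ R.map s) :
    hR.lift f' g' h' = R.map (hp.lift f g h) := by
  subst hf hg
  apply hR.hom_ext
  · rw [hR.lift_fst, ← R.map_comp, hp.lift_fst]
  · rw [hR.lift_snd, ← R.map_comp, hp.lift_snd]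

/-- The image of an internal groupoid under a right adjoint functor. -/
def InternalGroupoid.mapRightAdjoint {C : Type u} [Category.{v} C] {D : Type w} [Category.{v'} D]
    {L : D ⥤ C} {R : C ⥤ D} (adj : L ⊣ R) (G : InternalGroupoid C) : InternalGroupoid D :=
  have := adj.rightAdjoint_preservesLimits
  have hR := R.map_isPullback G.isPullback
  { G₀ := R.obj G.G₀
    G₁ := R.obj G.G₁
    G₂ := R.obj G.G₂
    s := R.map G.s
    t := R.map G.t
    e := R.map G.e
    i := R.map G.i
    p₁ := R.map G.p₁
    p₂ := R.map G.p₂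
    m := R.map G.m
    isPullback := hR
    e_s := by rw [← R.map_comp, G.e_s, R.map_id]
    e_t := by rw [← R.map_comp, G.e_t, R.map_id]
    m_s := by rw [← R.map_comp, G.m_s, R.map_comp]
    m_t := by rw [← R.map_comp, G.m_t, R.map_comp]
    i_s := by rw [← R.map_comp, G.i_s]
    i_t := by rw [← R.map_comp, G.i_t]
    i_i := by rw [← R.map_comp, G.i_i, R.map_id]
    id_comp := by
      rw [map_lift G.isPullback hR
        (by rw [Category.assoc, G.e_t, Category.comp_id, Category.id_comp])
        (R.map_comp _ _).symm (R.map_id _).symm, ← R.map_comp,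
        G.id_comp, R.map_id]
    comp_id := by
      rw [map_lift G.isPullback hR
        (by rw [Category.assoc, G.e_s, Category.comp_id, Category.id_comp])
        (R.map_id _).symm (R.map_comp _ _).symm, ← R.map_comp,
        G.comp_id, R.map_id]
    comp_inv := by
      rw [map_lift G.isPullback hR (by rw [G.i_s, Category.id_comp]) (R.map_id _).symm rfl,
        ← R.map_comp, G.comp_inv, R.map_comp]
    inv_comp := by
      rw [map_lift G.isPullback hR (by rw [G.i_t, Category.id_comp]) rfl (R.map_id _).symm,
        ← R.map_comp, G.inv_comp, R.map_comp]
    assoc := fun f g h hfg hgh => by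
      -- Both sides are transposed to morphisms from the image of the test object under `L`, where
      -- the law is associativity in `G` for the transposed arrows.
      apply (adj.homEquiv _ _).symm.injective
      simp only [adj.homEquiv_naturality_right_symm, homEquiv_symm_lift adj G.isPullback]
      exact G.assoc _ _ _
        (by rw [← adj.homEquiv_naturality_right_symm, hfg, adj.homEquiv_naturality_right_symm])
        (by rw [← adj.homEquiv_naturality_right_symm, hgh, adj.homEquiv_naturality_right_symm]) }

end rightAdjoint

/-- A localic groupoid whose locales are spatial arises from the topological groupoid of its
points. -/
theorem LocalicGroupoid.arisesFrom_points (G : LocalicGroupoid.{u})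
    (h₀ : IsIso (Locale.adjunctionTopToLocalePT.counit.app G.G₀))
    (h₁ : IsIso (Locale.adjunctionTopToLocalePT.counit.app G.G₁))
    (h₂ : IsIso (Locale.adjunctionTopToLocalePT.counit.app G.G₂)) :
    LocalicGroupoid.ArisesFrom G (G.mapRightAdjoint Locale.adjunctionTopToLocalePT) :=
  let ε := Locale.adjunctionTopToLocalePT.counit
  -- The three isomorphisms are components of one natural transformation, so each required square is
  -- a naturality square at a structure map.
  ⟨@asIso _ _ _ _ (ε.app G.G₀) h₀, @asIso _ _ _ _ (ε.app G.G₁) h₁,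
    @asIso _ _ _ _ (ε.app G.G₂) h₂, ε.naturality G.s,
    ε.naturality G.t, ε.naturality G.e, ε.naturality G.i, ε.naturality G.p₁, ε.naturality G.p₂,
    ε.naturality G.m⟩

theorem isSpatial_of_isIso_counit {X : Locale.{u}}
    (h : IsIso (Locale.adjunctionTopToLocalePT.counit.app X)) : IsSpatial X :=
  ⟨Locale.pt.obj X, ⟨asIso (Locale.adjunctionTopToLocalePT.counit.app X)⟩⟩

end Geom

theorem mainTheorem5 (T : Geom.GeomTheory.{u, w}) (hT : T.IsCountable) :
    (Geom.IsCountablyPresented T.groupoid.G₀ ∧ Geom.IsCountablyPresented T.groupoid.G₁ ∧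
      Geom.IsCountablyPresented T.groupoid.G₂) ∧
    (Geom.IsSpatial T.groupoid.G₀ ∧ Geom.IsSpatial T.groupoid.G₁ ∧
      Geom.IsSpatial T.groupoid.G₂) ∧
    ∃ H : Geom.TopologicalGroupoid.{u}, Geom.LocalicGroupoid.ArisesFrom T.groupoid H := by
  -- The locales of objects, of arrows and of composable pairs classify `T`, `T.chain 1` and
  -- `T.chain 2`, so the same result is applied to three countable theories.
  have h₀ := T.P.isIso_counit hT.countable_rel
  have h₁ := (T.chain 1).P.isIso_counit (hT.chain 1).countable_rel
  have h₂ := (T.chain 2).P.isIso_counit (hT.chain 2).countable_rel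
  exact ⟨⟨hT.isCountablyPresented, (hT.chain 1).isCountablyPresented,
      (hT.chain 2).isCountablyPresented⟩,
    ⟨Geom.isSpatial_of_isIso_counit h₀, Geom.isSpatial_of_isIso_counit h₁,
      Geom.isSpatial_of_isIso_counit h₂⟩,
    _, Geom.LocalicGroupoid.arisesFrom_points T.groupoid h₀ h₁ h₂⟩
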